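/- Truth values are $\{\pm 1\}$, with $-1=\mathrm{TRUE}$ and $1=\mathrm{FALSE}$. A *boolean relation* of arity $k>0$ is a subset of $\{\pm1\}^k$, and a *constraint language* $\mathcal L$ is a collection of boolean relations. A *constraint* on a set of variables $X$ is a pair $(S,R)$, where $R$ is a relation of some arity $k$ and $S$ is a sequence of length $k$ over $X\cup\{\pm1\}$; a *boolean constraint system (BCS)* is a finite set of variables with a finite set of constraints on them. A *BCS with contexts* is $B=(X,\{(U_i,V_i)\}_{i=1}^{\ell})$, where $X$ is a finite set of variables, $U_i\subseteq X$, and $(U_i,V_i)$ is a BCS on the variables $U_i$; it is *over $\mathcal L$* if all its relations belong to $\mathcal L$. The algebra $\mathcal A(B)$ is the unital complex $*$-algebra generated by $X$ subject to the relations $x^2=1$ and $x^*=x$ for $x\in X$; $xy=yx$ whenever $x,y\in U_i$ for some $i$; and $\prod_{x\in U_i}\tfrac12(1+\phi(x)x)=0$ for every $i$ and every assignment $\phi:U_i\to\{\pm1\}$ which does not satisfy $(U_i,V_i)$. Let $\mathcal R$ be the hyperfinite $\mathrm{II}_1$ factor, with trace $\tau$ and $\|a\|_2=\tau(a^*a)^{1/2}$,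 and for a nonprincipal ultrafilter $\mathcal U$ on $\mathbb N$ let $\mathcal R^{\mathcal U}=\ell^\infty(\mathbb N,\mathcal R)/\{(a_n):\lim_{n\to\mathcal U}\|a_n\|_2=0\}$ be its tracial ultrapower. We say that $B$ is *tracially satisfiable* if $\mathcal A(B)$ has a tracial state, and *$\mathcal R^{\mathcal U}$-satisfiable* if there is a unital $*$-homomorphism $\mathcal A(B)\to\mathcal R^{\mathcal U}$. A relation is *bijunctive* (respectively *Horn*, *dual Horn*) if it is the set of satisfying assignments of a CNF formula in which every clause has at most two literals (respectively at most one positive literal, at most one negative literal), and it is *linear* if it is the solution set of a system of linear equations over $\mathbb Z/2$. A constraint language is bijunctive, Horn or dual Horn if all its relations are. Let LIN be the constraint language of all linear relations. **Proposition.** Let $\mathcal U$ be a nonprincipal ultrafilter on $\mathbb N$. If there is a BCS with contexts over LIN which is tracially satisfiable but not $\mathcal R^{\mathcal U}$-satisfiable, then for every constraint language $\mathcal L$ which is not bijunctive, not Horn and not dual Horn, there is a BCS with contexts over $\mathcal L$ which is tracially satisfiable but not $\mathcal R^{\mathcal U}$-satisfiable. -/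

import Mathlib

open scoped ENNReal ComplexOrder

noncomputable section

namespace BCSAlgebra

/-! ### Complex `*`-algebras: quotients and presentations -/

section StarQuotient

variable {A : Type*} [Ring A] [StarRing A]

/-- The relation on a `*`-ring identifying every element of `S`, and its adjoint, with `0`. -/
def StarQuot.Rel (S : Set A) : A → A → Prop := fun a b => (a ∈ S ∨ star a ∈ S) ∧ b = 0

/-- The quotient of a `*`-algebra by the two-sided `*`-ideal generated by `S`.  When the two-sided
ideal generated by `S` is already closed under `*`, this is the quotient by that ideal. -/
def StarQuot (S : Set A) : Type _ := RingQuot (StarQuot.Rel S)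

instance StarQuot.instRing (S : Set A) : Ring (StarQuot S) :=
  inferInstanceAs (Ring (RingQuot (StarQuot.Rel S)))

instance StarQuot.instAlgebra [Algebra ℂ A] (S : Set A) : Algebra ℂ (StarQuot S) :=
  inferInstanceAs (Algebra ℂ (RingQuot (StarQuot.Rel S)))

instance StarQuot.instStarRing (S : Set A) : StarRing (StarQuot S) :=
  RingQuot.starRing (StarQuot.Rel S) (by
    rintro a b ⟨h, rfl⟩
    refine ⟨?_, star_zero A⟩
    rw [star_star]
    exact h.symm)

/-- The quotient map. -/
def StarQuot.mk [Algebra ℂ A] (S : Set A) : A →ₐ[ℂ] StarQuot S :=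
  RingQuot.mkAlgHom ℂ (StarQuot.Rel S)

theorem StarQuot.mk_eq_zero [Algebra ℂ A] {S : Set A} {a : A} (h : a ∈ S) :
    StarQuot.mk S a = 0 := by
  rw [← map_zero (StarQuot.mk S)]
  exact RingQuot.mkAlgHom_rel ℂ ⟨Or.inl h, rfl⟩

end StarQuotient

section FreeStarAlgebra

/-- The free unital complex `*`-algebra on `X`, as the algebra of noncommutative polynomials in the
letters `inl x` (standing for `x`) and `inr x` (standing for `x*`). -/
def FreeStarAlgebra (X : Type*) : Type _ := FreeAlgebra ℂ (X ⊕ X)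

variable {X : Type*}

instance FreeStarAlgebra.instRing : Ring (FreeStarAlgebra X) :=
  inferInstanceAs (Ring (FreeAlgebra ℂ (X ⊕ X)))

instance FreeStarAlgebra.instAlgebra : Algebra ℂ (FreeStarAlgebra X) :=
  inferInstanceAs (Algebra ℂ (FreeAlgebra ℂ (X ⊕ X)))

/-- A letter `x` or `x*`. -/
def FreeStarAlgebra.letter (y : X ⊕ X) : FreeStarAlgebra X := FreeAlgebra.ι ℂ y

/-- The involution: conjugate the scalars, reverse the words, and exchange `x` with `x*`. -/
def FreeStarAlgebra.starHom : FreeStarAlgebra X →+* (FreeStarAlgebra X)ᵐᵒᵖ :=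
  letI : Algebra ℂ (FreeStarAlgebra X)ᵐᵒᵖ :=
    RingHom.toAlgebra' ((algebraMap ℂ (FreeStarAlgebra X)ᵐᵒᵖ).comp (starRingEnd ℂ))
      (fun c x => Algebra.commutes ((starRingEnd ℂ) c) x)
  ((FreeAlgebra.lift ℂ
    (fun y : X ⊕ X => MulOpposite.op (FreeStarAlgebra.letter y.swap))).toRingHom :)

theorem FreeStarAlgebra.starHom_letter (y : X ⊕ X) :
    FreeStarAlgebra.starHom (FreeStarAlgebra.letter y) =
      MulOpposite.op (FreeStarAlgebra.letter y.swap) := by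
  let _ : Algebra ℂ (FreeStarAlgebra X)ᵐᵒᵖ :=
    RingHom.toAlgebra' ((algebraMap ℂ (FreeStarAlgebra X)ᵐᵒᵖ).comp (starRingEnd ℂ))
      (fun c x => Algebra.commutes ((starRingEnd ℂ) c) x)
  exact FreeAlgebra.lift_ι_apply (R := ℂ)
    (fun y : X ⊕ X => MulOpposite.op (FreeStarAlgebra.letter y.swap)) y

theorem FreeStarAlgebra.starHom_algebraMap (c : ℂ) :
    FreeStarAlgebra.starHom (algebraMap ℂ (FreeStarAlgebra X) c) =
      MulOpposite.op (algebraMap ℂ (FreeStarAlgebra X) (starRingEnd ℂ c)) := by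
  let _ : Algebra ℂ (FreeStarAlgebra X)ᵐᵒᵖ :=
    RingHom.toAlgebra' ((algebraMap ℂ (FreeStarAlgebra X)ᵐᵒᵖ).comp (starRingEnd ℂ))
      (fun c x => Algebra.commutes ((starRingEnd ℂ) c) x)
  exact (FreeAlgebra.lift ℂ
    (fun y : X ⊕ X => MulOpposite.op (FreeStarAlgebra.letter y.swap))).commutes c

theorem FreeStarAlgebra.starHom_starHom (a : FreeStarAlgebra X) :
    (starHom (starHom a).unop).unop = a := by
  refine FreeAlgebra.induction ℂ (X ⊕ X)
    (motive := fun a : FreeStarAlgebra X => (starHom (starHom a).unop).unop = a)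
    ?_ ?_ ?_ ?_ a
  · intro c
    have h := starHom_algebraMap (X := X) c
    have h' := starHom_algebraMap (X := X) (starRingEnd ℂ c)
    change (starHom (starHom (algebraMap ℂ (FreeStarAlgebra X) c)).unop).unop =
      algebraMap ℂ (FreeStarAlgebra X) c
    rw [h, MulOpposite.unop_op, h', MulOpposite.unop_op, Complex.conj_conj]
  · intro y
    change (starHom (starHom (letter y)).unop).unop = letter y
    rw [starHom_letter, MulOpposite.unop_op, starHom_letter, MulOpposite.unop_op, Sum.swap_swap]
  · intro a b ha hb
    erw [map_mul, MulOpposite.unop_mul, map_mul, MulOpposite.unop_mul, ha, hb]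
    rfl
  · intro a b ha hb
    erw [map_add, MulOpposite.unop_add, map_add, MulOpposite.unop_add, ha, hb]
    rfl

instance FreeStarAlgebra.instStarRing : StarRing (FreeStarAlgebra X) where
  star a := (starHom a).unop
  star_involutive := starHom_starHom
  star_mul a b := by simp
  star_add a b := by simp

/-- The generator `x`. -/
def FreeStarAlgebra.gen (x : X) : FreeStarAlgebra X := letter (Sum.inl x)

end FreeStarAlgebra

/-! ### Boolean relations, constraint languages and constraint systems

The group `ℤˣ = {1, -1}` is the set of truth values: `-1` is TRUE and `1` is FALSE. -/

/-- A boolean relation of arity `k > 0`. -/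
structure BoolRel where
  arity : ℕ
  arity_pos : 0 < arity
  carrier : Set (Fin arity → ℤˣ)

/-- A boolean constraint language: a collection of relations. -/
abbrev ConstraintLanguage := Set BoolRel

/-- A constraint `(S, R)` on `X`; the scope `S` is a sequence over `X ∪ {±1}`. -/
structure Constraint (X : Type) where
  rel : BoolRel
  scope : Fin rel.arity → X ⊕ ℤˣ

/-- The value of a variable or constant under an assignment. -/
def termValue {X : Type} (φ : X → ℤˣ) : X ⊕ ℤˣ → ℤˣ := Sum.elim φ id

/-- A boolean constraint system on the variables `X`: a finite set of constraints. -/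
structure BCS (X : Type) where
  constraints : Set (Constraint X)
  finite_constraints : constraints.Finite

/-- `φ` is a satisfying assignment. -/
def BCS.Satisfies {X : Type} (V : BCS X) (φ : X → ℤˣ) : Prop :=
  ∀ C ∈ V.constraints, (fun j => termValue φ (C.scope j)) ∈ C.rel.carrier

/-- Every relation of the system belongs to `L`. -/
def BCS.Over {X : Type} (V : BCS X) (L : ConstraintLanguage) : Prop :=
  ∀ C ∈ V.constraints, C.rel ∈ L

/-- A boolean constraint system with contexts `(X, {(U i, V i)})`. -/
structure ContextBCS where
  X : Type
  finite_X : Finite X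
  numContexts : ℕ
  U : Fin numContexts → Finset X
  V : ∀ i, BCS {x // x ∈ U i}

/-- Every relation of the system belongs to `L`. -/
def ContextBCS.Over (B : ContextBCS) (L : ConstraintLanguage) : Prop := ∀ i, (B.V i).Over L

/-! ### Schaefer classes -/

/-- A literal in `k` boolean variables: a term (a variable or a constant), with the flag `true` for
a positive literal and `false` for a negated term. -/
abbrev Literal (k : ℕ) := (Fin k ⊕ ℤˣ) × Bool

/-- The literal is TRUE under the assignment `v`. -/
def Literal.Holds {k : ℕ} (l : Literal k) (v : Fin k → ℤˣ) : Prop :=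
  termValue v l.1 = if l.2 then -1 else 1

/-- A clause: a disjunction of literals. -/
abbrev Clause (k : ℕ) := List (Literal k)

/-- A CNF formula: a conjunction of clauses. -/
abbrev CNF (k : ℕ) := List (Clause k)

/-- The satisfying assignments of a CNF. -/
def CNF.solutions {k : ℕ} (F : CNF k) : Set (Fin k → ℤˣ) :=
  {v | ∀ c ∈ F, ∃ l ∈ c, Literal.Holds l v}

/-- Definable by a CNF with at most two literals in every clause. -/
def BoolRel.IsBijunctive (R : BoolRel) : Prop :=
  ∃ F : CNF R.arity, (∀ c ∈ F, c.length ≤ 2) ∧ R.carrier = F.solutions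

/-- Definable by a CNF with at most one positive literal in every clause. -/
def BoolRel.IsHorn (R : BoolRel) : Prop :=
  ∃ F : CNF R.arity, (∀ c ∈ F, c.countP (fun l => l.2) ≤ 1) ∧ R.carrier = F.solutions

/-- Definable by a CNF with at most one negative literal in every clause. -/
def BoolRel.IsDualHorn (R : BoolRel) : Prop :=
  ∃ F : CNF R.arity, (∀ c ∈ F, c.countP (fun l => !l.2) ≤ 1) ∧ R.carrier = F.solutions

/-- The solution set of a linear system over `ℤ/2`; in multiplicative notation, the equation
`(J, b)` reads `∏ j ∈ J, v j = b`. -/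
def BoolRel.IsLinear (R : BoolRel) : Prop :=
  ∃ E : List (Finset (Fin R.arity) × ℤˣ), R.carrier = {v | ∀ e ∈ E, ∏ j ∈ e.1, v j = e.2}

def ConstraintLanguage.IsBijunctive (L : ConstraintLanguage) : Prop := ∀ R ∈ L, R.IsBijunctive

def ConstraintLanguage.IsHorn (L : ConstraintLanguage) : Prop := ∀ R ∈ L, R.IsHorn

def ConstraintLanguage.IsDualHorn (L : ConstraintLanguage) : Prop := ∀ R ∈ L, R.IsDualHorn

/-- The constraint language of all linear relations. -/
def LIN : ConstraintLanguage := {R | R.IsLinear}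

/-! ### The BCS algebra -/

namespace ContextBCS

variable (B : ContextBCS)

/-- The relations `x² = 1`, `x* = x`, and `xy = yx` for `x`, `y` in a common context. -/
def conRelations : Set (FreeStarAlgebra B.X) :=
  {r | ∃ x, r = FreeStarAlgebra.gen x ^ 2 - 1} ∪
  {r | ∃ x, r = star (FreeStarAlgebra.gen x) - FreeStarAlgebra.gen x} ∪
  {r | ∃ i, ∃ x ∈ B.U i, ∃ y ∈ B.U i,
    r = FreeStarAlgebra.gen x * FreeStarAlgebra.gen y -
      FreeStarAlgebra.gen y * FreeStarAlgebra.gen x}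

/-- The `*`-algebra generated by `X` subject to `conRelations`. -/
abbrev ConAlgebra : Type := StarQuot B.conRelations

/-- The generator `x`. -/
def conGen (x : B.X) : B.ConAlgebra := StarQuot.mk B.conRelations (FreeStarAlgebra.gen x)

theorem conGen_commute {i : Fin B.numContexts} {x y : B.X} (hx : x ∈ B.U i) (hy : y ∈ B.U i) :
    Commute (B.conGen x) (B.conGen y) := by
  have h := StarQuot.mk_eq_zero (S := B.conRelations) (Or.inr ⟨i, x, hx, y, hy, rfl⟩)
  rw [map_sub, map_mul, map_mul, sub_eq_zero] at h
  exact h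

/-- The element `(1 + φ(x) x) / 2`. -/
def conFactor {i : Fin B.numContexts} (φ : {x // x ∈ B.U i} → ℤˣ) (x : {x // x ∈ B.U i}) :
    B.ConAlgebra :=
  (1 / 2 : ℂ) • (1 + ((φ x : ℤ) : ℂ) • B.conGen x)

theorem conFactor_commute {i : Fin B.numContexts} (φ : {x // x ∈ B.U i} → ℤˣ)
    (x y : {x // x ∈ B.U i}) : Commute (B.conFactor φ x) (B.conFactor φ y) := by
  have h := B.conGen_commute x.2 y.2
  exact ((((Commute.one_left _).add_left
    (((Commute.one_right _).add_right (h.smul_right _)).smul_left _)).smul_left _).smul_right _)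

/-- The projection `∏ x ∈ U i, (1 + φ(x) x) / 2`. -/
def contextProj (i : Fin B.numContexts) (φ : {x // x ∈ B.U i} → ℤˣ) : B.ConAlgebra :=
  Finset.univ.noncommProd (B.conFactor φ) (fun x _ y _ _ => B.conFactor_commute φ x y)

/-- The relations killing the projections of the non-satisfying assignments. -/
def satRelations : Set B.ConAlgebra :=
  {p | ∃ i, ∃ φ : {x // x ∈ B.U i} → ℤˣ, ¬ (B.V i).Satisfies φ ∧ p = B.contextProj i φ}

/-- The boolean constraint system algebra of `B`. -/
abbrev Algebra : Type := StarQuot B.satRelations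

end ContextBCS

/-! ### Tracial states -/

section States

variable {A : Type*} [Ring A] [Algebra ℂ A] [StarRing A]

/-- `x` is a sum of elements of the form `s* s`. -/
def IsPositiveElement (x : A) : Prop :=
  ∃ (k : ℕ) (s : Fin k → A), 1 ≤ k ∧ x = ∑ i, star (s i) * s i

/-- `f` is a tracial state. -/
structure IsTracialState (f : A →ₗ[ℂ] ℂ) : Prop where
  map_star : ∀ x, f (star x) = star (f x)
  map_nonneg : ∀ x, IsPositiveElement x → 0 ≤ f x
  map_one : f 1 = 1
  map_mul_comm : ∀ x y, f (x * y) = f (y * x)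

end States

/-! ### Group von Neumann algebras and the hyperfinite II₁ factor -/

section VonNeumann

/-- The von Neumann algebra generated by a set of operators. -/
def vonNeumannClosure {H : Type*} [NormedAddCommGroup H] [InnerProductSpace ℂ H] [CompleteSpace H]
    (S : Set (H →L[ℂ] H)) : VonNeumannAlgebra H where
  toStarSubalgebra :=
    StarSubalgebra.centralizer ℂ (StarSubalgebra.centralizer ℂ S : Set (H →L[ℂ] H))
  centralizer_centralizer' := by simp

variable (G : Type)

/-- The Hilbert space `ℓ²(G)`. -/
abbrev L2 : Type := lp (fun _ : G => ℂ) 2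

variable {G}

theorem memlp_comp (e : G ≃ G) (f : L2 G) : Memℓp (fun h => f (e h)) 2 := by
  have := lp.memℓp f
  rw [memℓp_gen_iff (by norm_num)] at this ⊢
  exact (e.summable_iff (f := fun h => ‖f h‖ ^ (2 : ℝ≥0∞).toReal)).2 this

/-- The operator on `ℓ²(G)` permuting the coordinates by `e`. -/
def permOp (e : G ≃ G) : L2 G →L[ℂ] L2 G :=
  LinearMap.mkContinuous
    { toFun := fun f => ⟨fun h => f (e h), memlp_comp e f⟩
      map_add' := fun _ _ => rfl
      map_smul' := fun _ _ => rfl } 1 (by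
    intro f
    rw [one_mul, lp.norm_eq_tsum_rpow (by norm_num), lp.norm_eq_tsum_rpow (by norm_num)]
    exact le_of_eq (congrArg (fun t : ℝ => t ^ (1 / (2 : ℝ≥0∞).toReal))
      (e.tsum_eq (fun h => ‖f h‖ ^ (2 : ℝ≥0∞).toReal))))

@[simp] theorem permOp_apply (e : G ≃ G) (f : L2 G) (h : G) : permOp e f h = f (e h) := rfl

theorem star_permOp (e : G ≃ G) : star (permOp e) = permOp e.symm := by
  rw [ContinuousLinearMap.star_eq_adjoint]
  symm
  rw [ContinuousLinearMap.eq_adjoint_iff]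
  intro x y
  rw [lp.inner_eq_tsum, lp.inner_eq_tsum, ← e.tsum_eq]
  simp

variable [Group G]

/-- Left translation `(λ_g f)(h) = f(g⁻¹ h)`. -/
def leftTranslation (g : G) : L2 G →L[ℂ] L2 G := permOp (Equiv.mulLeft g⁻¹)

variable (G) in
/-- The group von Neumann algebra `L(G)`, generated by the left regular representation. -/
def groupVN : VonNeumannAlgebra (L2 G) := vonNeumannClosure (Set.range (leftTranslation (G := G)))

variable (G) in
/-- The `*`-algebra of the elements of `L(G)`. -/
abbrev GroupVNAlgebra : Type := (groupVN G).toStarSubalgebra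

open Classical in
variable (G) in
/-- The unit vector `δ_e`. -/
def deltaOne : L2 G := lp.single 2 (1 : G) (1 : ℂ)

/-- The canonical trace `τ(x) = ⟨δ_e, x δ_e⟩` on `L(G)`. -/
def groupTrace (x : GroupVNAlgebra G) : ℂ := inner ℂ (deltaOne G) ((x : L2 G →L[ℂ] L2 G) (deltaOne G))

/-- The trace norm `‖x‖₂ = τ(x* x)^(1/2)`. -/
def traceNorm (x : GroupVNAlgebra G) : ℝ := Real.sqrt (groupTrace (star x * x)).re

theorem traceNorm_eq (x : GroupVNAlgebra G) :
    traceNorm x = ‖(x : L2 G →L[ℂ] L2 G) (deltaOne G)‖ := by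
  have h : groupTrace (star x * x) = inner ℂ ((x : L2 G →L[ℂ] L2 G) (deltaOne G))
      ((x : L2 G →L[ℂ] L2 G) (deltaOne G)) := by
    change inner ℂ (deltaOne G) ((star (x : L2 G →L[ℂ] L2 G)) _) = _
    rw [ContinuousLinearMap.star_eq_adjoint, ContinuousLinearMap.adjoint_inner_right]
    rfl
  rw [traceNorm, h]
  exact (norm_eq_sqrt_re_inner (𝕜 := ℂ) _).symm

theorem commute_rightTranslation (x : GroupVNAlgebra G) (g : G) :
    (x : L2 G →L[ℂ] L2 G) * permOp (Equiv.mulRight g) =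
      permOp (Equiv.mulRight g) * (x : L2 G →L[ℂ] L2 G) := by
  have hx : (x : L2 G →L[ℂ] L2 G) ∈ StarSubalgebra.centralizer ℂ
    (StarSubalgebra.centralizer ℂ (Set.range (leftTranslation (G := G))) : Set _) := x.2
  rw [StarSubalgebra.mem_centralizer_iff] at hx
  refine ((hx (permOp (Equiv.mulRight g)) ?_).1).symm
  rw [SetLike.mem_coe, StarSubalgebra.mem_centralizer_iff]
  rintro _ ⟨h, rfl⟩
  rw [leftTranslation, star_permOp]
  constructor
  · ext f k
    simp [ContinuousLinearMap.mul_def, mul_assoc]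
  · ext f k
    simp [ContinuousLinearMap.mul_def, mul_assoc]

open Classical in
theorem permOp_deltaOne (g : G) :
    permOp (Equiv.mulRight g⁻¹) (deltaOne G) = lp.single 2 g (1 : ℂ) := by
  ext k
  simp [deltaOne, lp.single_apply, Pi.single_apply, mul_inv_eq_one]

theorem star_apply_deltaOne (x : GroupVNAlgebra G) (g : G) :
    ((star x : GroupVNAlgebra G) : L2 G →L[ℂ] L2 G) (deltaOne G) g =
      star ((x : L2 G →L[ℂ] L2 G) (deltaOne G) g⁻¹) := by
  classical
  have h1 := lp.inner_single_left (𝕜 := ℂ) g (1 : ℂ)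
    (((star x : GroupVNAlgebra G) : L2 G →L[ℂ] L2 G) (deltaOne G))
  have h2 := lp.inner_single_right (𝕜 := ℂ) g⁻¹ (1 : ℂ) ((x : L2 G →L[ℂ] L2 G) (deltaOne G))
  have h3 : inner ℂ (lp.single 2 g (1 : ℂ) : L2 G)
      (((star x : GroupVNAlgebra G) : L2 G →L[ℂ] L2 G) (deltaOne G)) =
      inner ℂ ((x : L2 G →L[ℂ] L2 G) (deltaOne G)) (lp.single 2 g⁻¹ (1 : ℂ) : L2 G) := by
    change inner ℂ _ ((star (x : L2 G →L[ℂ] L2 G)) _) = _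
    rw [ContinuousLinearMap.star_eq_adjoint, ContinuousLinearMap.adjoint_inner_right,
      ← permOp_deltaOne, ← permOp_deltaOne, inv_inv]
    have := congrArg (fun T : L2 G →L[ℂ] L2 G => T (deltaOne G)) (commute_rightTranslation x g⁻¹)
    simp only [ContinuousLinearMap.mul_def, ContinuousLinearMap.comp_apply] at this
    rw [this, ← ContinuousLinearMap.adjoint_inner_right, ← ContinuousLinearMap.star_eq_adjoint,
      star_permOp]
    simp
  rw [h1, h2] at h3
  simpa using h3

theorem traceNorm_star (x : GroupVNAlgebra G) : traceNorm (star x) = traceNorm x := by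
  rw [traceNorm_eq, traceNorm_eq, lp.norm_eq_tsum_rpow (by norm_num),
    lp.norm_eq_tsum_rpow (by norm_num), ← (Equiv.inv G).tsum_eq]
  refine congrArg (fun t : ℝ => t ^ (1 / (2 : ℝ≥0∞).toReal)) (tsum_congr fun g => ?_)
  rw [star_apply_deltaOne, Equiv.inv_apply, inv_inv, norm_star]

theorem traceNorm_mul_le (x y : GroupVNAlgebra G) : traceNorm (x * y) ≤ ‖x‖ * traceNorm y := by
  rw [traceNorm_eq, traceNorm_eq]
  exact (x : L2 G →L[ℂ] L2 G).le_opNorm _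

theorem traceNorm_mul_le' (x y : GroupVNAlgebra G) : traceNorm (x * y) ≤ ‖y‖ * traceNorm x := by
  rw [← traceNorm_star, star_mul, ← traceNorm_star x]
  refine (traceNorm_mul_le _ _).trans (le_of_eq ?_)
  rw [show ‖star y‖ = ‖y‖ from norm_star (y : L2 G →L[ℂ] L2 G)]

theorem traceNorm_add_le (x y : GroupVNAlgebra G) : traceNorm (x + y) ≤ traceNorm x + traceNorm y := by
  rw [traceNorm_eq, traceNorm_eq, traceNorm_eq]
  exact norm_add_le _ _

theorem traceNorm_nonneg (x : GroupVNAlgebra G) : 0 ≤ traceNorm x := Real.sqrt_nonneg _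

end VonNeumann

/-- The group of finitely supported permutations of `ℕ`. -/
def finitaryPerm : Subgroup (Equiv.Perm ℕ) where
  carrier := {σ | {n | σ n ≠ n}.Finite}
  one_mem' := by simp
  mul_mem' := by
    intro σ τ hσ hτ
    refine (hσ.union hτ).subset (fun n hn => ?_)
    by_contra h
    simp only [Set.mem_union, Set.mem_ofPred_eq, not_or, not_not] at h
    exact hn (by rw [Equiv.Perm.mul_apply, h.2, h.1])
  inv_mem' := by
    intro σ hσ
    refine Set.Finite.subset hσ (fun n hn h => hn ?_)
    rw [Equiv.Perm.inv_eq_iff_eq, h]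

/-- The hyperfinite II₁ factor `𝓡`, in the standard model of Murray and von Neumann: the von Neumann
algebra of the group of finitely supported permutations of `ℕ`, a countable group with infinite
conjugacy classes that is the increasing union of the finite symmetric groups. -/
abbrev hyperfiniteFactor : VonNeumannAlgebra (L2 finitaryPerm) := groupVN finitaryPerm

/-- The `*`-algebra of the elements of `𝓡`. -/
abbrev HyperfiniteFactor : Type := GroupVNAlgebra finitaryPerm

/-! ### The tracial ultrapower of `𝓡` -/

/-- The `*`-algebra `ℓ^∞(ℕ, 𝓡)` of norm-bounded sequences in `𝓡`. -/
def boundedSeq : StarSubalgebra ℂ (ℕ → HyperfiniteFactor) where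
  carrier := {x | ∃ C : ℝ, ∀ n, ‖x n‖ ≤ C}
  mul_mem' := by
    rintro x y ⟨C, hC⟩ ⟨D, hD⟩
    exact ⟨C * D, fun n => (norm_mul_le _ _).trans
      (mul_le_mul (hC n) (hD n) (norm_nonneg _) ((norm_nonneg _).trans (hC n)))⟩
  add_mem' := by
    rintro x y ⟨C, hC⟩ ⟨D, hD⟩
    exact ⟨C + D, fun n => (norm_add_le _ _).trans (add_le_add (hC n) (hD n))⟩
  algebraMap_mem' c := ⟨‖algebraMap ℂ HyperfiniteFactor c‖, fun n => le_rfl⟩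
  star_mem' := by
    rintro x ⟨C, hC⟩
    exact ⟨C, fun n => (norm_star (x n : L2 finitaryPerm →L[ℂ] L2 finitaryPerm)).trans_le (hC n)⟩

open Filter in
/-- The ideal of bounded sequences with `lim_U ‖x n‖₂ = 0`. -/
def nullIdeal (U : Ultrafilter ℕ) : TwoSidedIdeal boundedSeq :=
  TwoSidedIdeal.mk' {x | Tendsto (fun n => traceNorm ((x : ℕ → HyperfiniteFactor) n)) U (nhds 0)}
    (by
      have h : traceNorm (0 : HyperfiniteFactor) = 0 := by simp [traceNorm_eq]
      simp [h])
    (by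
      intro x y hx hy
      have h := Tendsto.add hx hy
      rw [add_zero] at h
      exact squeeze_zero (fun n => traceNorm_nonneg _) (fun n => traceNorm_add_le _ _) h)
    (by
      intro x hx
      refine Tendsto.congr (fun n => ?_) hx
      simp [traceNorm_eq])
    (by
      rintro ⟨x, C, hC⟩ y hy
      have h := Tendsto.const_mul C hy
      rw [mul_zero] at h
      exact squeeze_zero (fun n => traceNorm_nonneg _) (fun n => (traceNorm_mul_le _ _).trans
        (mul_le_mul_of_nonneg_right (hC n) (traceNorm_nonneg _))) h)
    (by
      rintro x ⟨y, C, hC⟩ hx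
      have h := Tendsto.const_mul C hx
      rw [mul_zero] at h
      exact squeeze_zero (fun n => traceNorm_nonneg _) (fun n => (traceNorm_mul_le' _ _).trans
        (mul_le_mul_of_nonneg_right (hC n) (traceNorm_nonneg _))) h)

/-- The tracial ultrapower `𝓡^U = ℓ^∞(ℕ, 𝓡) / {x | lim_U ‖x n‖₂ = 0}`. -/
abbrev HyperfiniteUltrapower (U : Ultrafilter ℕ) : Type :=
  StarQuot {x : boundedSeq | x ∈ nullIdeal U}

/-! ### Types of satisfiability -/

namespace ContextBCS

variable (B : ContextBCS)

/-- There is a (unital) `*`-homomorphism from the BCS algebra of `B` to `𝓡^U`. -/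
def IsUltrapowerSatisfiable (U : Ultrafilter ℕ) : Prop :=
  Nonempty (B.Algebra →⋆ₐ[ℂ] HyperfiniteUltrapower U)

/-- The BCS algebra of `B` has a tracial state. -/
def IsTraciallySatisfiable : Prop := ∃ f : B.Algebra →ₗ[ℂ] ℂ, IsTracialState f

end ContextBCS

end BCSAlgebra

end

/-! The argument has a combinatorial half and an algebraic half; nothing about the hyperfinite
factor or its ultrapower is needed beyond composition of homomorphisms.

Combinatorial half: every linear system is primitive positive definable, with constants, from a
language `L` outside the three classes. Horn relations are detected by closure under AND, dual Horn
relations by closure under OR, and bijunctive relations by closure under majority; only the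
direction "closed implies definable by such a CNF" is needed. Failures of closure under AND and OR
give two binary relations whose conjunction is `x = -y` (`ppDef_neg`). Once negation is available, a
failure of closure under majority gives a ternary relation that contains the three assignments with
a single TRUE and omits the all-FALSE one. Symmetrizing leaves four possible relations: the
3-clause, not-all-equal, odd parity and exactly-one. Each of them defines odd parity on three
variables (`ppDef_parity`), and chaining parities gives every linear equation (`ppDef_list_prod`).

Algebraic half: replace the system in each context by its definition over `L`, with existential
variables private to that context. Then there are `*`-homomorphisms in both directions between the
two algebras. Toward the extended algebra the original generators go to themselves
(`exists_hom_to_extend`). Back from it, each auxiliary variable goes to a `±1`-valued function of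
the commuting generators of its context, computed by a choice of existential witnesses
(`exists_hom_of_extend`). The second map pulls back a tracial state to the extended system;
composition with the first turns a representation of the extended system into one of the original.
So the separation passes to `L`. -/

noncomputable section

namespace BCSAlgebra

/-! ### Universal properties -/

section Lift

variable {A C : Type*} [Ring A] [StarRing A] [Algebra ℂ A] [Ring C] [StarRing C] [Algebra ℂ C]

theorem StarQuot.star_mk (S : Set A) (a : A) : star (mk S a) = mk S (star a) := by
  have h : ∀ b : A, mk S b = (⟨Quot.mk _ b⟩ : RingQuot (Rel S)) := fun b => by
    change RingQuot.mkAlgHom ℂ (Rel S) b = _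
    simp [RingQuot.mkAlgHom_def, RingQuot.mkRingHom_def]
  rw [h, h]
  rfl

theorem StarQuot.mk_surjective (S : Set A) : Function.Surjective (mk S) :=
  RingQuot.mkAlgHom_surjective ℂ (Rel S)

instance StarQuot.instStarModule [StarModule ℂ A] (S : Set A) : StarModule ℂ (StarQuot S) where
  star_smul c a := by
    obtain ⟨a, rfl⟩ := mk_surjective S a
    rw [← map_smul, star_mk, star_mk, star_smul, map_smul]

/-- A `*`-homomorphism vanishing on `S` factors through the quotient by `S`. -/
def StarQuot.lift {S : Set A} (f : A →⋆ₐ[ℂ] C) (hf : ∀ a ∈ S, f a = 0) : StarQuot S →⋆ₐ[ℂ] C :=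
  let g : StarQuot S →ₐ[ℂ] C := RingQuot.liftAlgHom ℂ ⟨(f : A →ₐ[ℂ] C), by
    rintro a b ⟨h | h, rfl⟩
    · simpa using hf a h
    · simpa [map_star] using hf _ h⟩
  have hg : ∀ a, g (mk S a) = f a := fun a => RingQuot.liftAlgHom_mkAlgHom_apply ..
  { g with
    map_star' := by
      intro x
      obtain ⟨a, rfl⟩ := mk_surjective S x
      change g (star (mk S a)) = star (g (mk S a))
      rw [star_mk, hg, hg, map_star] }

@[simp] theorem StarQuot.lift_mk {S : Set A} (f : A →⋆ₐ[ℂ] C) (hf : ∀ a ∈ S, f a = 0) (a : A) :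
    StarQuot.lift f hf (mk S a) = f a :=
  RingQuot.liftAlgHom_mkAlgHom_apply ..

variable {X : Type*}

theorem FreeStarAlgebra.star_letter (y : X ⊕ X) : star (letter y) = letter y.swap := by
  change (starHom (letter y)).unop = _
  rw [starHom_letter, MulOpposite.unop_op]

theorem FreeStarAlgebra.star_algebraMap (c : ℂ) :
    star (algebraMap ℂ (FreeStarAlgebra X) c) = algebraMap ℂ _ (star c) := by
  change (starHom (algebraMap ℂ (FreeStarAlgebra X) c)).unop = _
  rw [starHom_algebraMap, MulOpposite.unop_op]
  rfl

instance FreeStarAlgebra.instStarModule : StarModule ℂ (FreeStarAlgebra X) where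
  star_smul c a := by
    have h : star (algebraMap ℂ (FreeStarAlgebra X) c * a) =
        star a * star (algebraMap ℂ (FreeStarAlgebra X) c) := star_mul _ _
    rw [Algebra.smul_def, h, star_algebraMap, ← Algebra.commutes, ← Algebra.smul_def]

/-- The `*`-homomorphism out of the free `*`-algebra with prescribed values on the generators. -/
def FreeStarAlgebra.lift [StarModule ℂ C] (g : X → C) : FreeStarAlgebra X →⋆ₐ[ℂ] C :=
  let F : FreeStarAlgebra X →ₐ[ℂ] C := FreeAlgebra.lift ℂ (Sum.elim g fun x => star (g x))
  have hF : ∀ y, F (letter y) = Sum.elim g (fun x => star (g x)) y :=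
    fun y => FreeAlgebra.lift_ι_apply ..
  { F with
    map_star' := by
      have hmul : ∀ a b : FreeStarAlgebra X, F (star a) = star (F a) → F (star b) = star (F b) →
          F (star (a * b)) = star (F (a * b)) := by
        intro a b ha hb
        rw [star_mul, map_mul, map_mul, ha, hb, star_mul]
      have hadd : ∀ a b : FreeStarAlgebra X, F (star a) = star (F a) → F (star b) = star (F b) →
          F (star (a + b)) = star (F (a + b)) := by
        intro a b ha hb
        rw [star_add, map_add, map_add, ha, hb, star_add]
      intro a
      change F (star a) = star (F a)
      refine FreeAlgebra.induction ℂ (X ⊕ X)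
        (motive := fun a : FreeStarAlgebra X => F (star a) = star (F a)) ?_ ?_ hmul hadd a
      · intro c
        change F (star (algebraMap ℂ (FreeStarAlgebra X) c)) =
          star (F (algebraMap ℂ (FreeStarAlgebra X) c))
        rw [star_algebraMap, AlgHom.commutes, AlgHom.commutes, algebraMap_star_comm]
      · intro y
        change F (star (letter y)) = star (F (letter y))
        rw [star_letter, hF, hF]
        cases y <;> simp }

@[simp] theorem FreeStarAlgebra.lift_gen [StarModule ℂ C] (g : X → C) (x : X) :
    FreeStarAlgebra.lift g (gen x) = g x :=
  FreeAlgebra.lift_ι_apply ..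

end Lift

/-! ### Joint eigen-elements of commuting involutions -/

section Eigen

variable {A ι : Type*} [Ring A] [Algebra ℂ A]

/-- `a` is a joint eigen-element for left multiplication by the family `u`, with eigenvalues `φ`. -/
def IsEigen (u : ι → A) (φ : ι → ℤˣ) (a : A) : Prop := ∀ x, u x * a = ((φ x : ℤ) : ℂ) • a

theorem intUnit_mul_self (e : ℤˣ) : ((e : ℤ) : ℂ) * ((e : ℤ) : ℂ) = 1 := by
  rcases Int.units_eq_one_or e with rfl | rfl <;> simp

theorem eq_zero_of_smul_eq {e d : ℤˣ} (h : e ≠ d) {a : A}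
    (ha : ((e : ℤ) : ℂ) • a = ((d : ℤ) : ℂ) • a) : a = 0 := by
  rw [← sub_eq_zero, ← sub_smul, smul_eq_zero, sub_eq_zero] at ha
  refine ha.resolve_left fun h' => h ?_
  exact Units.ext (by exact_mod_cast h')

theorem involution_mul_factor {u : A} (hu : u ^ 2 = 1) (e : ℤˣ) :
    u * ((1 / 2 : ℂ) • (1 + ((e : ℤ) : ℂ) • u)) =
      ((e : ℤ) : ℂ) • ((1 / 2 : ℂ) • (1 + ((e : ℤ) : ℂ) • u)) := by
  rw [mul_smul_comm, smul_comm ((e : ℤ) : ℂ)]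
  congr 1
  rw [mul_add, mul_one, mul_smul_comm, ← sq, hu, smul_add, smul_smul, intUnit_mul_self, one_smul,
    add_comm]

theorem factor_mul_eigen {u a : A} {e : ℤˣ} (h : u * a = ((e : ℤ) : ℂ) • a) :
    ((1 / 2 : ℂ) • (1 + ((e : ℤ) : ℂ) • u)) * a = a := by
  rw [smul_mul_assoc, add_mul, one_mul, smul_mul_assoc, h, smul_smul, intUnit_mul_self, one_smul,
    ← two_smul ℂ a, smul_smul]
  norm_num

/-- The joint spectral projections of a finite commuting family of involutions. -/
theorem exists_spectralProj [Fintype ι] [DecidableEq ι] (u : ι → A) (hsq : ∀ x, u x ^ 2 = 1)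
    (hcomm : ∀ x y, Commute (u x) (u y)) :
    ∃ E : (ι → ℤˣ) → A, (∀ φ, IsEigen u φ (E φ)) ∧ (∑ φ, E φ = 1) ∧
      (∀ z, (∀ x, Commute z (u x)) → ∀ φ, Commute z (E φ)) ∧
      ∀ φ a, IsEigen u φ a → E φ * a = a := by
  have hc : ∀ a ∈ Set.range u, ∀ b ∈ Set.range u, a * b = b * a := by
    rintro _ ⟨x, rfl⟩ _ ⟨y, rfl⟩
    exact hcomm x y
  -- The subalgebra generated by the involutions is commutative, so the spectral projections can be
  -- formed as ordinary finite products there.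
  let K := _root_.Algebra.adjoin ℂ (Set.range u)
  have : IsMulCommutative K := _root_.Algebra.isMulCommutative_adjoin ℂ hc
  let _ : CommRing K := { (inferInstance : Ring K) with mul_comm := mul_comm' }
  let v : ι → K := fun x => ⟨u x, _root_.Algebra.subset_adjoin ⟨x, rfl⟩⟩
  let p : (ι → ℤˣ) → ι → K := fun φ x => (1 / 2 : ℂ) • (1 + ((φ x : ℤ) : ℂ) • v x)
  let E' : (ι → ℤˣ) → K := fun φ => ∏ x, p φ x
  have hp : ∀ φ x, ((p φ x : K) : A) = (1 / 2 : ℂ) • (1 + ((φ x : ℤ) : ℂ) • u x) :=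
    fun _ _ => rfl
  refine ⟨fun φ => (E' φ : A), ?_, ?_, ?_, ?_⟩
  · intro φ x
    have h : (E' φ : A) = (p φ x : A) * ((∏ y ∈ Finset.univ.erase x, p φ y : K) : A) := by
      rw [← MulMemClass.coe_mul]
      exact congrArg _ (Finset.mul_prod_erase Finset.univ (p φ) (Finset.mem_univ x)).symm
    change u x * (E' φ : A) = ((φ x : ℤ) : ℂ) • (E' φ : A)
    rw [h, ← mul_assoc, hp, involution_mul_factor (hsq x), smul_mul_assoc]
  · have h : ∑ φ, E' φ = 1 := by
      -- For each `x` the two factors for `1` and `-1` add up to `1`; expanding the product over `x`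
      -- of these sums gives the sum of all projections.
      have h1 := Finset.prod_univ_sum (fun _ : ι => (Finset.univ : Finset ℤˣ))
        (fun x e => ((1 / 2 : ℂ) • (1 + ((e : ℤ) : ℂ) • v x) : K))
      rw [Fintype.piFinset_univ] at h1
      rw [← h1]
      refine Finset.prod_eq_one fun x _ => ?_
      rw [show (Finset.univ : Finset ℤˣ) = {1, -1} from rfl, Finset.sum_pair (by decide),
        ← smul_add]
      rw [show ((1 : K) + (((1 : ℤˣ) : ℤ) : ℂ) • v x + (1 + (((-1 : ℤˣ) : ℤ) : ℂ) • v x)) =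
        (2 : ℂ) • 1 by simp [two_smul]; abel, smul_smul]
      norm_num
    have h2 := congrArg (K.val) h
    rw [map_sum, map_one] at h2
    exact h2
  · intro z hz φ
    have hK : K ≤ Subalgebra.centralizer ℂ {z} := by
      refine _root_.Algebra.adjoin_le ?_
      rintro _ ⟨x, rfl⟩
      rw [SetLike.mem_coe, Subalgebra.mem_centralizer_iff]
      rintro _ rfl
      exact hz x
    exact (Subalgebra.mem_centralizer_iff ℂ).1 (hK (E' φ).2) z rfl
  · intro φ a ha
    refine Finset.prod_induction (p φ) (fun b : K => (b : A) * a = a) ?_ ?_ ?_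
    · intro b c hb hc'
      change ((b : A) * (c : A)) * a = a
      rw [mul_assoc, hc', hb]
    · exact one_mul a
    · intro x _
      rw [hp]
      exact factor_mul_eigen (ha x)

variable [Fintype ι] [DecidableEq ι]

/-- The unit is a sum of joint eigen-elements, so an element is determined by its left action on
them. This reduces later identities to computations with scalars. -/
theorem ext_of_isEigen {u : ι → A} (hsq : ∀ x, u x ^ 2 = 1)
    (hcomm : ∀ x y, Commute (u x) (u y)) {c d : A}
    (h : ∀ φ a, IsEigen u φ a → c * a = d * a) : c = d := by
  obtain ⟨E, hE, hsum, -, -⟩ := exists_spectralProj u hsq hcomm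
  rw [← mul_one c, ← mul_one d, ← hsum, Finset.mul_sum, Finset.mul_sum]
  exact Finset.sum_congr rfl fun φ _ => h φ _ (hE φ)

variable [StarRing A]

/-- Functional calculus for a finite commuting family of self-adjoint involutions, for
`±1`-valued functions. -/
theorem exists_functionalCalculus {u : ι → A} (hsq : ∀ x, u x ^ 2 = 1)
    (hstar : ∀ x, star (u x) = u x) (hcomm : ∀ x y, Commute (u x) (u y)) [StarModule ℂ A]
    (F : (ι → ℤˣ) → ℤˣ) :
    ∃ b : A, star b = b ∧ ∀ φ a, IsEigen u φ a → b * a = ((F φ : ℤ) : ℂ) • a := by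
  obtain ⟨E, hE, hsum, -, hfix⟩ := exists_spectralProj u hsq hcomm
  -- Taking adjoints, `star (E φ)` absorbs `u x` on its right as the scalar `φ x`, while `a` absorbs
  -- it on its left as `ψ x`; where the two differ, the product must vanish.
  have horth : ∀ φ ψ a, IsEigen u ψ a → φ ≠ ψ → star (E φ) * a = 0 := by
    intro φ ψ a ha hne
    obtain ⟨x, hx⟩ := Function.ne_iff.1 hne
    refine eq_zero_of_smul_eq hx ?_
    have h1 := congrArg star (hE φ x)
    rw [star_mul, hstar, star_smul] at h1
    have h2 : star ((φ x : ℤ) : ℂ) = ((φ x : ℤ) : ℂ) := by simp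
    rw [h2] at h1
    rw [← smul_mul_assoc, ← h1, mul_assoc, ha x, mul_smul_comm]
  have hself : ∀ φ, star (E φ) = E φ := by
    intro φ
    -- The right-hand side is self-adjoint, hence so is `E φ`.
    have h1 : star (E φ) = star (E φ) * E φ := by
      conv_lhs => rw [← mul_one (star (E φ)), ← hsum, Finset.mul_sum]
      refine Finset.sum_eq_single φ (fun ψ _ hne => horth φ ψ _ (hE ψ) hne.symm) (by simp)
    have h2 := congrArg star h1
    rw [star_mul, star_star] at h2
    exact h1.trans h2.symm
  refine ⟨∑ φ, ((F φ : ℤ) : ℂ) • E φ, ?_, ?_⟩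
  · rw [star_sum]
    refine Finset.sum_congr rfl fun φ _ => ?_
    rw [star_smul, hself]
    simp
  · intro φ a ha
    rw [Finset.sum_mul, Finset.sum_eq_single φ]
    · rw [smul_mul_assoc, hfix φ a ha]
    · intro ψ _ hne
      rw [smul_mul_assoc, ← hself, horth ψ φ a ha hne, smul_zero]
    · simp

end Eigen

/-! ### Homomorphisms out of the algebra of a constraint system -/

namespace ContextBCS

variable (B : ContextBCS)

/-- The generator `x` of the algebra of `B`. -/
def gen (x : B.X) : B.Algebra := StarQuot.mk B.satRelations (B.conGen x)

theorem gen_sq (x : B.X) : B.gen x ^ 2 = 1 := by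
  have h := StarQuot.mk_eq_zero (S := B.conRelations) (Or.inl (Or.inl ⟨x, rfl⟩))
  rw [map_sub, map_pow, map_one, sub_eq_zero] at h
  rw [gen, conGen, ← map_pow, h, map_one]

theorem star_gen (x : B.X) : star (B.gen x) = B.gen x := by
  have h := StarQuot.mk_eq_zero (S := B.conRelations) (Or.inl (Or.inr ⟨x, rfl⟩))
  rw [map_sub, sub_eq_zero] at h
  rw [gen, conGen, StarQuot.star_mk, StarQuot.star_mk, h]

theorem gen_commute {i : Fin B.numContexts} {x y : B.X} (hx : x ∈ B.U i) (hy : y ∈ B.U i) :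
    Commute (B.gen x) (B.gen y) := (B.conGen_commute hx hy).map (StarQuot.mk B.satRelations)

theorem map_conFactor {C : Type*} [Ring C] [_root_.Algebra ℂ C] {i : Fin B.numContexts}
    (f : B.ConAlgebra →ₐ[ℂ] C) (φ : {x // x ∈ B.U i} → ℤˣ) (x : {x // x ∈ B.U i}) :
    f (B.conFactor φ x) = (1 / 2 : ℂ) • (1 + ((φ x : ℤ) : ℂ) • f (B.conGen x)) := by
  rw [conFactor, map_smul, map_add, map_one, map_smul]

theorem map_contextProj_mul {C : Type*} [Ring C] [_root_.Algebra ℂ C] {i : Fin B.numContexts}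
    (f : B.ConAlgebra →ₐ[ℂ] C) (φ : {x // x ∈ B.U i} → ℤˣ) {a : C}
    (ha : IsEigen (fun x : {x // x ∈ B.U i} => f (B.conGen x)) φ a) :
    f (B.contextProj i φ) * a = a := by
  refine Finset.noncommProd_induction Finset.univ (B.conFactor φ) _
    (fun b => f b * a = a) ?_ ?_ ?_
  · intro b c hb hc
    rw [map_mul, mul_assoc, hc, hb]
  · rw [map_one, one_mul]
  · intro x _
    rw [map_conFactor]
    exact factor_mul_eigen (ha x)

theorem isEigen_contextProj {C : Type*} [Ring C] [_root_.Algebra ℂ C] {i : Fin B.numContexts}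
    (f : B.ConAlgebra →ₐ[ℂ] C) (hsq : ∀ x, f (B.conGen x) ^ 2 = 1)
    (φ : {x // x ∈ B.U i} → ℤˣ) :
    IsEigen (fun x : {x // x ∈ B.U i} => f (B.conGen x)) φ (f (B.contextProj i φ)) := by
  classical
  intro x
  change f (B.conGen x) * f (B.contextProj i φ) = ((φ x : ℤ) : ℂ) • f (B.contextProj i φ)
  have h : B.contextProj i φ = B.conFactor φ x * _ :=
    (Finset.mul_noncommProd_erase Finset.univ (Finset.mem_univ x) (B.conFactor φ)
      (fun x _ y _ _ => B.conFactor_commute φ x y)).symm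
  rw [h, map_mul, map_conFactor, ← mul_assoc, involution_mul_factor (hsq x), smul_mul_assoc]

/-- The context projection of `φ` fixes `a`, and it is one of the defining relations of the algebra.
-/
theorem eq_zero_of_isEigen {i : Fin B.numContexts} {φ : {x // x ∈ B.U i} → ℤˣ}
    (hφ : ¬ (B.V i).Satisfies φ) {a : B.Algebra}
    (ha : IsEigen (fun x : {x // x ∈ B.U i} => B.gen x) φ a) : a = 0 := by
  rw [← B.map_contextProj_mul (StarQuot.mk B.satRelations) φ ha,
    StarQuot.mk_eq_zero (S := B.satRelations) ⟨i, φ, hφ, rfl⟩, zero_mul]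

variable {C : Type*} [Ring C] [StarRing C] [_root_.Algebra ℂ C] [StarModule ℂ C]

/-- The universal property, with the satisfaction relations stated through eigen-elements rather
than noncommutative products. This suffices because the image of a context projection is itself an
eigen-element for its assignment. -/
theorem exists_starAlgHom (g : B.X → C) (hsq : ∀ x, g x ^ 2 = 1) (hstar : ∀ x, star (g x) = g x)
    (hcomm : ∀ i, ∀ x ∈ B.U i, ∀ y ∈ B.U i, Commute (g x) (g y))
    (hsat : ∀ i, ∀ φ : {x // x ∈ B.U i} → ℤˣ, ¬ (B.V i).Satisfies φ →
      ∀ a : C, IsEigen (fun x : {x // x ∈ B.U i} => g x) φ a → a = 0) :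
    Nonempty (B.Algebra →⋆ₐ[ℂ] C) := by
  let f : B.ConAlgebra →⋆ₐ[ℂ] C := StarQuot.lift (FreeStarAlgebra.lift g) (by
    rintro a ((⟨x, rfl⟩ | ⟨x, rfl⟩) | ⟨i, x, hx, y, hy, rfl⟩)
    · simp [hsq]
    · simp [map_star, hstar]
    · simp [(hcomm i x hx y hy).eq])
  have hf : ∀ x, f (B.conGen x) = g x := by
    intro x
    rw [conGen, StarQuot.lift_mk, FreeStarAlgebra.lift_gen]
  refine ⟨StarQuot.lift f ?_⟩
  rintro _ ⟨i, φ, hφ, rfl⟩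
  refine hsat i φ hφ _ ?_
  have h := B.isEigen_contextProj (i := i) (f : B.ConAlgebra →ₐ[ℂ] C) (fun x => by
    change f (B.conGen x) ^ 2 = 1
    rw [hf, hsq]) φ
  intro x
  have hx := h x
  change f (B.conGen x) * f _ = _ at hx
  rwa [hf] at hx

end ContextBCS

/-! ### Primitive positive definitions -/

/-- Substitute terms for the variables of a constraint. -/
def Constraint.subst {V V' : Type} (f : V → V' ⊕ ℤˣ) (C : Constraint V) : Constraint V' where
  rel := C.rel
  scope j := Sum.elim f Sum.inr (C.scope j)

theorem termValue_subst {V V' : Type} (f : V → V' ⊕ ℤˣ) (φ : V' → ℤˣ) (t : V ⊕ ℤˣ) :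
    termValue φ (Sum.elim f Sum.inr t) = termValue (fun v => termValue φ (f v)) t := by
  cases t <;> rfl

/-- Substitute terms for the variables of a constraint system. -/
def BCS.subst {V V' : Type} (f : V → V' ⊕ ℤˣ) (W : BCS V) : BCS V' where
  constraints := Constraint.subst f '' W.constraints
  finite_constraints := W.finite_constraints.image _

theorem BCS.satisfies_subst {V V' : Type} (f : V → V' ⊕ ℤˣ) (W : BCS V) (φ : V' → ℤˣ) :
    (W.subst f).Satisfies φ ↔ W.Satisfies (fun v => termValue φ (f v)) := by
  simp only [Satisfies, subst, Set.forall_mem_image, Constraint.subst, termValue_subst]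
  exact Iff.rfl

theorem BCS.Over.subst {V V' : Type} {L : ConstraintLanguage} {W : BCS V} (h : W.Over L)
    (f : V → V' ⊕ ℤˣ) : (W.subst f).Over L := by
  rintro _ ⟨C, hC, rfl⟩
  exact h C hC

/-- The union of two constraint systems. -/
def BCS.union {V : Type} (W W' : BCS V) : BCS V where
  constraints := W.constraints ∪ W'.constraints
  finite_constraints := W.finite_constraints.union W'.finite_constraints

theorem BCS.satisfies_union {V : Type} (W W' : BCS V) (φ : V → ℤˣ) :
    (W.union W').Satisfies φ ↔ W.Satisfies φ ∧ W'.Satisfies φ := by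
  simp only [Satisfies, union, Set.mem_union, or_imp, forall_and]

/-- The predicate `P` on assignments is definable by an existentially quantified conjunction of
constraints from `L`, with constants. -/
def PPDef (L : ConstraintLanguage) {V : Type} (P : (V → ℤˣ) → Prop) : Prop :=
  ∃ (Y : Type) (_ : Finite Y) (W : BCS (V ⊕ Y)), W.Over L ∧
    ∀ φ, P φ ↔ ∃ ψ : Y → ℤˣ, W.Satisfies (Sum.elim φ ψ)

namespace PPDef

variable {L : ConstraintLanguage} {V V' : Type} {P Q : (V → ℤˣ) → Prop}

theorem congr (h : PPDef L P) (hPQ : ∀ φ, Q φ ↔ P φ) : PPDef L Q := by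
  obtain rfl : Q = P := funext fun φ => propext (hPQ φ)
  exact h

theorem true : PPDef L (fun _ : V → ℤˣ => True) :=
  ⟨Empty, inferInstance, ⟨∅, Set.finite_empty⟩, fun _ h => h.elim,
    fun _ => ⟨fun _ => ⟨Empty.elim, fun _ h => h.elim⟩, fun _ => trivial⟩⟩

theorem of_mem {R : BoolRel} (hR : R ∈ L) : PPDef L (fun φ => φ ∈ R.carrier) := by
  refine ⟨Empty, inferInstance, ⟨{⟨R, fun j => Sum.inl (Sum.inl j)⟩}, Set.finite_singleton _⟩,
    ?_, ?_⟩
  · rintro _ rfl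
    exact hR
  · intro φ
    simp [BCS.Satisfies, termValue]

theorem subst (h : PPDef L P) (f : V → V' ⊕ ℤˣ) :
    PPDef L (fun φ : V' → ℤˣ => P fun v => termValue φ (f v)) := by
  obtain ⟨Y, hY, W, hW, hP⟩ := h
  refine ⟨Y, hY, W.subst (Sum.elim (fun v => Sum.map Sum.inl id (f v)) fun y => Sum.inl (Sum.inr y)),
    hW.subst _, fun φ => ?_⟩
  simp only [hP, BCS.satisfies_subst]
  refine exists_congr fun ψ => iff_of_eq (congrArg _ (funext fun v => ?_))
  rcases v with v | y
  · simp only [Sum.elim_inl]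
    cases f v <;> rfl
  · rfl

theorem rename (h : PPDef L P) (f : V → V') : PPDef L (fun φ : V' → ℤˣ => P fun v => φ (f v)) :=
  h.subst fun v => Sum.inl (f v)

theorem and (hP : PPDef L P) (hQ : PPDef L Q) : PPDef L (fun φ => P φ ∧ Q φ) := by
  obtain ⟨Y, hY, W, hW, hP⟩ := hP
  obtain ⟨Z, hZ, W', hW', hQ⟩ := hQ
  refine ⟨Y ⊕ Z, inferInstance,
    (W.subst (Sum.elim (fun v => Sum.inl (Sum.inl v)) fun y => Sum.inl (Sum.inr (Sum.inl y)))).union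
    (W'.subst (Sum.elim (fun v => Sum.inl (Sum.inl v)) fun y => Sum.inl (Sum.inr (Sum.inr y)))),
    ?_, fun φ => ?_⟩
  · rintro C (hC | hC)
    · exact hW.subst _ C hC
    · exact hW'.subst _ C hC
  · simp only [hP, hQ, BCS.satisfies_union, BCS.satisfies_subst]
    have key : ∀ (χ : Y ⊕ Z → ℤˣ),
        ((fun v : V ⊕ Y => termValue (Sum.elim φ χ) (Sum.elim (fun v => Sum.inl (Sum.inl v))
          (fun y => Sum.inl (Sum.inr (Sum.inl y))) v)) = Sum.elim φ fun y => χ (Sum.inl y)) ∧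
        ((fun v : V ⊕ Z => termValue (Sum.elim φ χ) (Sum.elim (fun v => Sum.inl (Sum.inl v))
          (fun y => Sum.inl (Sum.inr (Sum.inr y))) v)) = Sum.elim φ fun y => χ (Sum.inr y)) := by
      intro χ
      constructor <;> (funext v; cases v <;> rfl)
    constructor
    · rintro ⟨⟨ψ, hψ⟩, χ, hχ⟩
      refine ⟨Sum.elim ψ χ, ?_, ?_⟩
      · rw [(key _).1]; exact hψ
      · rw [(key _).2]; exact hχ
    · rintro ⟨χ, h1, h2⟩
      rw [(key _).1] at h1
      rw [(key _).2] at h2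
      exact ⟨⟨_, h1⟩, _, h2⟩

theorem exists_ {Y : Type} [Finite Y] {P : (V ⊕ Y → ℤˣ) → Prop} (h : PPDef L P) :
    PPDef L (fun φ => ∃ ψ : Y → ℤˣ, P (Sum.elim φ ψ)) := by
  obtain ⟨Z, hZ, W, hW, hP⟩ := h
  refine ⟨Y ⊕ Z, inferInstance, W.subst fun v => Sum.inl (Equiv.sumAssoc V Y Z v), hW.subst _,
    fun φ => ?_⟩
  simp only [hP, BCS.satisfies_subst]
  have key : ∀ (χ : Y ⊕ Z → ℤˣ), (fun v => termValue (Sum.elim φ χ)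
      (Sum.inl (Equiv.sumAssoc V Y Z v))) =
      Sum.elim (Sum.elim φ fun y => χ (Sum.inl y)) fun z => χ (Sum.inr z) := by
    intro χ
    funext v
    rcases v with (v | v) | v <;> rfl
  constructor
  · rintro ⟨ψ, χ, h⟩
    refine ⟨Sum.elim ψ χ, ?_⟩
    rw [key]
    exact h
  · rintro ⟨χ, h⟩
    rw [key] at h
    exact ⟨_, _, h⟩

theorem exists_unit {P : (V ⊕ Unit → ℤˣ) → Prop} (h : PPDef L P) :
    PPDef L (fun φ => ∃ z : ℤˣ, P (Sum.elim φ fun _ => z)) :=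
  h.exists_.congr fun _ => ⟨fun ⟨z, h⟩ => ⟨fun _ => z, h⟩, fun ⟨ψ, h⟩ => ⟨ψ (), h⟩⟩

theorem forall_mem {κ : Type*} {s : Set κ} (hs : s.Finite) {P : κ → (V → ℤˣ) → Prop}
    (h : ∀ k ∈ s, PPDef L (P k)) : PPDef L (fun φ => ∀ k ∈ s, P k φ) := by
  induction s, hs using Set.Finite.induction_on with
  | empty => exact PPDef.true.congr (by simp)
  | insert _ _ ih =>
    exact ((h _ (Set.mem_insert _ _)).and (ih fun k hk => h k (Set.mem_insert_of_mem _ hk))).congr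
      (by simp)

theorem forall_ {κ : Type*} [Finite κ] {P : κ → (V → ℤˣ) → Prop} (h : ∀ k, PPDef L (P k)) :
    PPDef L (fun φ => ∀ k, P k φ) :=
  (forall_mem (Set.finite_univ) fun k _ => h k).congr (by simp)

end PPDef

/-! ### Extending the contexts by auxiliary variables -/

namespace ContextBCS

section Extend

variable (B : ContextBCS) (Y : Fin B.numContexts → Type)
  (W : ∀ i, BCS ({x // x ∈ B.U i} ⊕ Y i))

/-- The variables of the `i`-th extended context. -/
def extendVar (i : Fin B.numContexts) : {x // x ∈ B.U i} ⊕ Y i → B.X ⊕ Σ i, Y i :=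
  Sum.map Subtype.val (Sigma.mk i)

theorem extendVar_injective (i : Fin B.numContexts) : Function.Injective (B.extendVar Y i) :=
  Sum.map_injective.2 ⟨Subtype.val_injective, sigma_mk_injective⟩

variable [∀ i, Finite (Y i)]

/-- Replace the `i`-th constraint system by a system with the additional variables `Y i`. -/
def extend : ContextBCS where
  X := B.X ⊕ Σ i, Y i
  finite_X := by
    have := B.finite_X
    infer_instance
  numContexts := B.numContexts
  U i := (Set.finite_range (B.extendVar Y i)).toFinset
  V i := (W i).subst fun v => Sum.inl ⟨B.extendVar Y i v, by simp⟩

variable {B Y W}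

theorem extend_over {L : ConstraintLanguage} (hW : ∀ i, (W i).Over L) : (B.extend Y W).Over L :=
  fun i => (hW i).subst _

theorem extendVar_mem (i : Fin B.numContexts) (v : {x // x ∈ B.U i} ⊕ Y i) :
    B.extendVar Y i v ∈ (B.extend Y W).U i :=
  (Set.Finite.mem_toFinset _).2 ⟨v, rfl⟩

theorem mem_extend_U {i : Fin B.numContexts} {z : B.X ⊕ Σ i, Y i} :
    z ∈ (B.extend Y W).U i ↔ ∃ v, B.extendVar Y i v = z :=
  Set.Finite.mem_toFinset _

theorem extend_satisfies {i : Fin B.numContexts} {χ : {z // z ∈ (B.extend Y W).U i} → ℤˣ} :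
    ((B.extend Y W).V i).Satisfies χ ↔
      (W i).Satisfies fun v => χ ⟨B.extendVar Y i v, extendVar_mem i v⟩ :=
  BCS.satisfies_subst _ _ _

/-- If the extended system is implied by the original one, the algebra of the original system maps
to the algebra of the extension. -/
theorem exists_hom_to_extend
    (hW : ∀ i φ ψ, (W i).Satisfies (Sum.elim φ ψ) → (B.V i).Satisfies φ) :
    Nonempty (B.Algebra →⋆ₐ[ℂ] (B.extend Y W).Algebra) := by
  classical
  have hmem : ∀ i, ∀ x ∈ B.U i, (Sum.inl x : B.X ⊕ Σ i, Y i) ∈ (B.extend Y W).U i :=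
    fun i x hx => extendVar_mem i (Sum.inl ⟨x, hx⟩)
  have hmem' : ∀ (i : Fin B.numContexts) (y : Y i), (Sum.inr ⟨i, y⟩ : B.X ⊕ Σ i, Y i) ∈ (B.extend Y W).U i :=
    fun i y => extendVar_mem i (Sum.inr y)
  refine B.exists_starAlgHom (fun x => (B.extend Y W).gen (Sum.inl x)) (fun x => gen_sq _ _)
    (fun x => star_gen _ _) (fun i x hx y hy => gen_commute _ (hmem i x hx) (hmem i y hy)) ?_
  intro i φ hφ a ha
  have := Fintype.ofFinite (Y i)
  obtain ⟨E, hE, hsum, hEc, -⟩ := exists_spectralProj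
    (fun y : Y i => (B.extend Y W).gen (Sum.inr ⟨i, y⟩)) (fun y => gen_sq _ _)
    (fun y z => gen_commute _ (hmem' i y) (hmem' i z))
  -- Split `a` along the spectral projections of the auxiliary variables. Each piece `E ψ * a` is an
  -- eigen-element for the combined assignment `(φ, ψ)`, which cannot satisfy `W i` since `φ`
  -- violates `V i`.
  rw [← one_mul a, ← hsum, Finset.sum_mul]
  refine Finset.sum_eq_zero fun ψ _ => ?_
  -- The chosen preimage is the expected one because `extendVar` is injective.
  let χ : {z // z ∈ (B.extend Y W).U i} → ℤˣ :=
    fun z => Sum.elim φ ψ (mem_extend_U.1 z.2).choose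
  have hχ : ∀ v, χ ⟨B.extendVar Y i v, extendVar_mem i v⟩ = Sum.elim φ ψ v := fun v =>
    congrArg (Sum.elim φ ψ) (B.extendVar_injective Y i 
      (mem_extend_U.1 (extendVar_mem (W := W) i v)).choose_spec)
  refine eq_zero_of_isEigen (B.extend Y W) (i := i) (φ := χ) (fun h => hφ (hW i φ ψ ?_)) ?_
  · rw [extend_satisfies (i := i)] at h
    simpa only [hχ] using h
  · rintro ⟨z, hz⟩
    obtain ⟨v, rfl⟩ := mem_extend_U.1 hz
    rw [hχ]
    rcases v with x | y
    · change (B.extend Y W).gen (Sum.inl x) * (E ψ * a) = ((φ x : ℤ) : ℂ) • (E ψ * a)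
      have hx := ha x
      dsimp only at hx
      rw [← mul_assoc, (hEc _ (fun y => gen_commute _ (hmem i x x.2) (hmem' i y)) ψ).eq, mul_assoc,
        hx, mul_smul_comm]
    · change (B.extend Y W).gen (Sum.inr ⟨i, y⟩) * (E ψ * a) = ((ψ y : ℤ) : ℂ) • (E ψ * a)
      have hy := hE ψ y
      dsimp only at hy
      rw [← mul_assoc, hy, smul_mul_assoc]

/-- If every satisfying assignment of the original system extends, the algebra of the extension maps
to the algebra of the original system. -/
theorem exists_hom_of_extend
    (hW : ∀ i φ, (B.V i).Satisfies φ → ∃ ψ, (W i).Satisfies (Sum.elim φ ψ)) :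
    Nonempty ((B.extend Y W).Algebra →⋆ₐ[ℂ] B.Algebra) := by
  classical
  -- `G i φ` is a witness for the existential variables when `φ` satisfies `V i`, and arbitrary
  -- otherwise. The auxiliary generator `y` will act on the `φ`-eigenspace as the scalar `G i φ y`.
  choose! G hG using hW
  have hsq : ∀ i, ∀ x : {x // x ∈ B.U i}, B.gen x ^ 2 = 1 := fun i x => B.gen_sq x
  have hcomm : ∀ i, ∀ x y : {x // x ∈ B.U i}, Commute (B.gen x) (B.gen y) :=
    fun i x y => B.gen_commute x.2 y.2
  have hb : ∀ i y, ∃ b : B.Algebra, star b = b ∧ ∀ (φ : {x // x ∈ B.U i} → ℤˣ) a,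
      IsEigen (fun x : {x // x ∈ B.U i} => B.gen x) φ a → b * a = ((G i φ y : ℤ) : ℂ) • a :=
    fun i y => exists_functionalCalculus (hsq i) (fun x => B.star_gen x) (hcomm i) fun φ => G i φ y
  choose b hbstar hb using hb
  -- All images of variables of one context act by scalars on the same eigen-elements, which makes
  -- them commute.
  have hscal : ∀ i v, ∃ e : ({x // x ∈ B.U i} → ℤˣ) → ℤˣ, ∀ φ a,
      IsEigen (fun x : {x // x ∈ B.U i} => B.gen x) φ a →
      Sum.elim B.gen (fun y => b y.1 y.2) (B.extendVar Y i v) * a = ((e φ : ℤ) : ℂ) • a := by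
    rintro i (x | y)
    · exact ⟨fun φ => φ x, fun φ a ha => ha x⟩
    · exact ⟨fun φ => G i φ y, fun φ a ha => hb i y φ a ha⟩
  refine (B.extend Y W).exists_starAlgHom (Sum.elim B.gen fun y => b y.1 y.2) ?_ ?_ ?_ ?_
  · rintro (x | ⟨i, y⟩)
    · exact B.gen_sq x
    · refine ext_of_isEigen (hsq i) (hcomm i) fun φ a ha => ?_
      change b i y ^ 2 * a = 1 * a
      rw [sq, mul_assoc, hb i y φ a ha, mul_smul_comm, hb i y φ a ha, smul_smul, intUnit_mul_self,
        one_smul, one_mul]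
  · rintro (x | ⟨i, y⟩)
    · exact B.star_gen x
    · exact hbstar i y
  · intro (i : Fin B.numContexts) z hz z' hz'
    obtain ⟨v, rfl⟩ := mem_extend_U.1 hz
    obtain ⟨v', rfl⟩ := mem_extend_U.1 hz'
    obtain ⟨e, he⟩ := hscal i v
    obtain ⟨e', he'⟩ := hscal i v'
    refine ext_of_isEigen (hsq i) (hcomm i) fun φ a ha => ?_
    rw [mul_assoc, mul_assoc, he' φ a ha, he φ a ha, mul_smul_comm, mul_smul_comm, he φ a ha,
      he' φ a ha, smul_comm]
  · intro (i : Fin B.numContexts) χ hχ a ha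
    rw [extend_satisfies (i := i)] at hχ
    set φ : {x // x ∈ B.U i} → ℤˣ := fun x =>
      χ ⟨B.extendVar Y i (Sum.inl x), extendVar_mem i _⟩ with hφ
    set ψ : Y i → ℤˣ := fun y => χ ⟨B.extendVar Y i (Sum.inr y), extendVar_mem i _⟩ with hψ
    have ha' : IsEigen (fun x : {x // x ∈ B.U i} => B.gen x) φ a :=
      fun x => ha ⟨B.extendVar Y i (Sum.inl x), extendVar_mem i _⟩
    -- If `φ` satisfies `V i`, then `ψ` is not the chosen witness, so some auxiliary generator acts
    -- on `a` by two different scalars. Otherwise `a` already vanishes in the algebra of `B`.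
    by_cases hsat : (B.V i).Satisfies φ
    · have hne : G i φ ≠ ψ := by
        intro h
        refine hχ ?_
        convert hG i φ hsat using 1
        rw [h]
        funext v
        cases v <;> rfl
      obtain ⟨y, hy⟩ := Function.ne_iff.1 hne
      exact eq_zero_of_smul_eq hy ((hb i y φ a ha').symm.trans
        (ha ⟨B.extendVar Y i (Sum.inr y), extendVar_mem i _⟩))
    · exact B.eq_zero_of_isEigen hsat ha'

end Extend

theorem IsTraciallySatisfiable.of_hom {B B' : ContextBCS} (h : B.IsTraciallySatisfiable)
    (f : B'.Algebra →⋆ₐ[ℂ] B.Algebra) : B'.IsTraciallySatisfiable := by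
  obtain ⟨τ, hτ⟩ := h
  refine ⟨τ ∘ₗ (f : B'.Algebra →ₐ[ℂ] B.Algebra).toLinearMap, ?_, ?_, ?_, ?_⟩
  · intro x
    change τ (f (star x)) = star (τ (f x))
    rw [map_star, hτ.map_star]
  · rintro _ ⟨k, s, hk, rfl⟩
    refine hτ.map_nonneg _ ⟨k, fun i => f (s i), hk, ?_⟩
    change f (∑ i, star (s i) * s i) = _
    simp only [map_sum, map_mul, map_star]
  · change τ (f 1) = 1
    rw [map_one, hτ.map_one]
  · intro x y
    change τ (f (x * y)) = τ (f (y * x))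
    rw [map_mul f, map_mul f, hτ.map_mul_comm]

theorem IsUltrapowerSatisfiable.of_hom {U : Ultrafilter ℕ} {B B' : ContextBCS}
    (h : B'.IsUltrapowerSatisfiable U) (f : B.Algebra →⋆ₐ[ℂ] B'.Algebra) :
    B.IsUltrapowerSatisfiable U :=
  h.map fun g => g.comp f

/-- Primitive positive definitions of the constraint systems of the contexts transfer separations of
tracial satisfiability from `𝓡^U`-satisfiability. -/
theorem exists_separation_of_ppDef {U : Ultrafilter ℕ} {L : ConstraintLanguage} (B : ContextBCS)
    (hpp : ∀ i, PPDef L (B.V i).Satisfies) (htr : B.IsTraciallySatisfiable)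
    (hU : ¬ B.IsUltrapowerSatisfiable U) :
    ∃ B' : ContextBCS, B'.Over L ∧ B'.IsTraciallySatisfiable ∧ ¬ B'.IsUltrapowerSatisfiable U := by
  choose Y hY W hW hsat using hpp
  obtain ⟨f⟩ := exists_hom_to_extend (B := B) (Y := Y) (W := W)
    fun i φ ψ h => (hsat i φ).2 ⟨ψ, h⟩
  obtain ⟨g⟩ := exists_hom_of_extend (B := B) (Y := Y) (W := W) fun i φ h => (hsat i φ).1 h
  exact ⟨B.extend Y W, extend_over hW, htr.of_hom g, fun h => hU (h.of_hom f)⟩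

end ContextBCS

/-! ### Closure properties characterizing the Schaefer classes -/

/-- The cube is finite: conjoin, over all points outside `S`, one clause that holds on `S` and fails
at that point. -/
theorem exists_cnf_of_separating {k : ℕ} (S : Set (Fin k → ℤˣ)) (p : Clause k → Prop)
    (h : ∀ v, v ∉ S → ∃ c : Clause k, p c ∧ (∀ s ∈ S, ∃ l ∈ c, l.Holds s) ∧
      ¬ ∃ l ∈ c, l.Holds v) :
    ∃ F : CNF k, (∀ c ∈ F, p c) ∧ S = F.solutions := by
  classical
  choose! c hp hS hv using h
  refine ⟨(Finset.univ.filter (· ∉ S)).toList.map c, ?_, ?_⟩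
  · intro d hd
    obtain ⟨v, hv, rfl⟩ := List.mem_map.1 hd
    exact hp v (by simpa using hv)
  · ext s
    constructor
    · intro hs d hd
      obtain ⟨v, hv, rfl⟩ := List.mem_map.1 hd
      exact hS v (by simpa using hv) s hs
    · intro hs
      by_contra hn
      exact hv s hn (hs _ (List.mem_map.2 ⟨s, by simpa using hn, rfl⟩))

theorem unit_ne_iff {a b : ℤˣ} : a ≠ b ↔ a = -b := by revert a b; decide

/-- The truth value that makes a literal with the given flag hold. -/
def flagValue (b : Bool) : ℤˣ := if b then -1 else 1

theorem flagValue_not (b : Bool) : flagValue (!b) = -flagValue b := by cases b <;> rfl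

theorem Literal.holds_inl {k : ℕ} (i : Fin k) (b : Bool) (v : Fin k → ℤˣ) :
    Literal.Holds (Sum.inl i, b) v ↔ v i = flagValue b := Iff.rfl

/-- The coordinatewise meet, for the order in which `t` is the larger truth value. -/
def meetAt (t : ℤˣ) {κ : Type*} (a c : κ → ℤˣ) : κ → ℤˣ :=
  fun i => if a i = t ∧ c i = t then t else -t

/-- A point `v` outside `S` violates the clause `neg` negating its `t`-coordinates. Either `S`
satisfies this clause, or a forced coordinate supplies one literal of the other sign that repairs
it, or meets of elements of `S` above `v` produce `v` itself. -/
theorem exists_cnf_of_meet_closed {k : ℕ} (b : Bool) (S : Set (Fin k → ℤˣ))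
    (hS : ∀ a ∈ S, ∀ c ∈ S, meetAt (flagValue b) a c ∈ S) :
    ∃ F : CNF k, (∀ c ∈ F, c.countP (fun l => l.2 == b) ≤ 1) ∧ S = F.solutions := by
  classical
  set t := flagValue b with ht
  refine exists_cnf_of_separating S _ fun v hv => ?_
  let neg : Clause k := (Finset.univ.filter fun i => v i = t).toList.map fun i => (Sum.inl i, !b)
  have hneg : neg.countP (fun l => l.2 == b) = 0 := by
    rw [List.countP_eq_zero]
    intro l hl
    obtain ⟨i, -, rfl⟩ := List.mem_map.1 hl
    cases b <;> simp
  have hmem : ∀ i, (Sum.inl i, !b) ∈ neg ↔ v i = t := by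
    intro i
    simp [neg]
  have hnegv : ¬ ∃ l ∈ neg, l.Holds v := by
    rintro ⟨l, hl, hlv⟩
    obtain ⟨i, hi, rfl⟩ := List.mem_map.1 hl
    rw [Literal.holds_inl, flagValue_not, ← unit_ne_iff] at hlv
    exact hlv (by simpa using hi)
  have hnegs : ∀ s : Fin k → ℤˣ, (¬ ∃ l ∈ neg, l.Holds s) → ∀ i, v i = t → s i = t := by
    intro s hs i hi
    by_contra hne
    refine hs ⟨_, (hmem i).2 hi, ?_⟩
    rw [Literal.holds_inl, flagValue_not, ← unit_ne_iff]
    exact hne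
  by_cases hj : ∃ j, v j ≠ t ∧ ∀ s ∈ S, (∀ i, v i = t → s i = t) → s j = t
  · obtain ⟨j, hvj, hj⟩ := hj
    refine ⟨(Sum.inl j, b) :: neg, ?_, ?_, ?_⟩
    · rw [List.countP_cons, hneg]
      split <;> omega
    · intro s hs
      by_cases hsn : ∃ l ∈ neg, l.Holds s
      · obtain ⟨l, hl, h⟩ := hsn
        exact ⟨l, List.mem_cons_of_mem _ hl, h⟩
      · exact ⟨_, List.mem_cons_self, (Literal.holds_inl _ _ _).2 (hj s hs (hnegs s hsn))⟩
    · rintro ⟨l, hl, h⟩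
      rcases List.mem_cons.1 hl with rfl | hl
      · exact hvj h
      · exact hnegv ⟨l, hl, h⟩
  · refine ⟨neg, hneg.le.trans zero_le_one, ?_, hnegv⟩
    intro s hs
    by_contra hsn
    push Not at hj
    -- No coordinate is forced, so each `j` with `v j ≠ t` has an element of `S` above `v` agreeing
    -- with `v` at `j`; their meet agrees with `v` everywhere.
    have key : ∀ J : Finset (Fin k), (∀ j ∈ J, v j ≠ t) →
        ∃ m ∈ S, (∀ i, v i = t → m i = t) ∧ ∀ j ∈ J, m j ≠ t := by
      intro J
      induction J using Finset.induction_on with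
      | empty => exact fun _ => ⟨s, hs, hnegs s hsn, by simp⟩
      | insert j J _ ih =>
        intro hJ
        obtain ⟨m, hm, hmv, hmJ⟩ := ih fun i hi => hJ i (Finset.mem_insert_of_mem hi)
        obtain ⟨r, hr, hrv, hrj⟩ := hj j (hJ j (Finset.mem_insert_self _ _))
        refine ⟨_, hS m hm r hr, fun i hi => if_pos ⟨hmv i hi, hrv i hi⟩, ?_⟩
        intro i hi
        have : ¬ (m i = t ∧ r i = t) := by
          rcases Finset.mem_insert.1 hi with rfl | hi
          · exact fun h => hrj h.2
          · exact fun h => hmJ i hi h.1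
        rw [meetAt, if_neg this, unit_ne_iff]
    obtain ⟨m, hm, hmv, hmJ⟩ := key (Finset.univ.filter fun j => v j ≠ t) (by simp)
    refine hv ?_
    convert hm using 1
    funext i
    by_cases hi : v i = t
    · rw [hi, hmv i hi]
    · rw [unit_ne_iff.1 hi, unit_ne_iff.1 (hmJ i (by simpa using hi))]

/-- The majority of three truth values. -/
def maj (a b c : ℤˣ) : ℤˣ := if a = b then a else c

/-- The Baker–Pixley argument: a majority-closed set is determined by its projections to pairs of
coordinates, so a point outside it is excluded by a clause on two coordinates. -/
theorem exists_cnf_of_maj_closed {k : ℕ} (hk : 0 < k) (S : Set (Fin k → ℤˣ))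
    (hS : ∀ a ∈ S, ∀ b ∈ S, ∀ c ∈ S, (fun i => maj (a i) (b i) (c i)) ∈ S) :
    ∃ F : CNF k, (∀ c ∈ F, c.length ≤ 2) ∧ S = F.solutions := by
  classical
  refine exists_cnf_of_separating S _ fun v hv => ?_
  by_cases hij : ∃ i j, ∀ s ∈ S, ¬ (s i = v i ∧ s j = v j)
  · obtain ⟨i, j, hij⟩ := hij
    have hlit : ∀ i, ∃ b : Bool, flagValue b = -v i := by
      intro i
      rcases Int.units_eq_one_or (v i) with h | h <;> rw [h]
      · exact ⟨true, rfl⟩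
      · exact ⟨false, rfl⟩
    choose b hb using hlit
    refine ⟨[(Sum.inl i, b i), (Sum.inl j, b j)], le_rfl, fun s hs => ?_, ?_⟩
    · simp only [List.mem_cons, List.not_mem_nil, or_false, exists_eq_or_imp, exists_eq_left,
        Literal.holds_inl, hb, ← unit_ne_iff]
      have := hij s hs
      tauto
    · simp only [List.mem_cons, List.not_mem_nil, or_false, exists_eq_or_imp, exists_eq_left,
        Literal.holds_inl, hb, ← unit_ne_iff]
      tauto
  · exfalso
    push Not at hij
    have key : ∀ n, ∀ J : Finset (Fin k), J.card = n → ∃ s ∈ S, ∀ i ∈ J, s i = v i := by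
      intro n
      induction n with
      | zero =>
        intro J hJ
        -- The empty set of coordinates only requires `S` to be nonempty, which follows from a
        -- degenerate pair.
        obtain ⟨s, hs, -⟩ := hij ⟨0, hk⟩ ⟨0, hk⟩
        exact ⟨s, hs, by simp [Finset.card_eq_zero.1 hJ]⟩
      | succ n ih =>
        intro J hJ
        by_cases h2 : 2 < J.card
        · obtain ⟨x, hx, y, hy, z, hz, hxy, hxz, hyz⟩ := Finset.two_lt_card.1 h2
          -- Three elements of `S` agree with `v` on `J` off `x`, `y`, `z` respectively. At every
          -- coordinate of `J` at most one of them is wrong, so the majority is right.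
          have her : ∀ w ∈ J, ∃ s ∈ S, ∀ i ∈ J, i ≠ w → s i = v i := by
            intro w hw
            obtain ⟨s, hs, h⟩ := ih (J.erase w) (by rw [Finset.card_erase_of_mem hw, hJ]; rfl)
            exact ⟨s, hs, fun i hi hne => h i (Finset.mem_erase.2 ⟨hne, hi⟩)⟩
          obtain ⟨r, hr, hr'⟩ := her x hx
          obtain ⟨s, hs, hs'⟩ := her y hy
          obtain ⟨u, hu, hu'⟩ := her z hz
          refine ⟨_, hS r hr s hs u hu, fun i hi => ?_⟩
          have hmaj : ∀ a b c d : ℤˣ, (a = d ∧ b = d) ∨ (a = d ∧ c = d) ∨ (b = d ∧ c = d) →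
              maj a b c = d := by
            unfold maj
            decide
          refine hmaj _ _ _ _ ?_
          have h1 := hr' i hi
          have h2 := hs' i hi
          have h3 := hu' i hi
          by_cases hix : i = x
          · subst hix
            exact Or.inr (Or.inr ⟨h2 hxy, h3 hxz⟩)
          · by_cases hiy : i = y
            · subst hiy
              exact Or.inr (Or.inl ⟨h1 hix, h3 hyz⟩)
            · exact Or.inl ⟨h1 hix, h2 hiy⟩
        · obtain ⟨x, y, hxy⟩ : ∃ x y, J ⊆ {x, y} := by
            have hc : J.card = 1 ∨ J.card = 2 := by omega
            rcases hc with hc | hc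
            · obtain ⟨x, rfl⟩ := Finset.card_eq_one.1 hc
              exact ⟨x, x, by simp⟩
            · obtain ⟨x, y, -, rfl⟩ := Finset.card_eq_two.1 hc
              exact ⟨x, y, subset_rfl⟩
          obtain ⟨s, hs, h1, h2⟩ := hij x y
          refine ⟨s, hs, fun i hi => ?_⟩
          rcases Finset.mem_insert.1 (hxy hi) with rfl | hi
          · exact h1
          · rw [Finset.mem_singleton.1 hi, h2]
    obtain ⟨s, hs, h⟩ := key _ Finset.univ rfl
    exact hv ((funext fun i => h i (Finset.mem_univ i)) ▸ hs)

/-! ### Definability of all linear relations -/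

section Definability

variable {L : ConstraintLanguage}

theorem exists_binary_of_not_meet_closed {R : BoolRel} (hR : R ∈ L) (t : ℤˣ)
    (h : ¬ ∀ a ∈ R.carrier, ∀ c ∈ R.carrier, meetAt t a c ∈ R.carrier) :
    ∃ P : ℤˣ → ℤˣ → Prop, PPDef L (fun φ : Fin 2 → ℤˣ => P (φ 0) (φ 1)) ∧
      P t (-t) ∧ P (-t) t ∧ ¬ P (-t) (-t) := by
  push Not at h
  obtain ⟨a, ha, c, hc, hac⟩ := h
  -- Coordinates where `a` and `c` agree become constants; the others become one of two variables
  -- according to which of `a`, `c` takes the value `t`. Then `(t, -t)` recovers `a`, `(-t, t)`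
  -- recovers `c`, and `(-t, -t)` gives their meet.
  let f : Fin R.arity → Fin 2 ⊕ ℤˣ := fun i =>
    if a i = c i then Sum.inr (a i) else if a i = t then Sum.inl 0 else Sum.inl 1
  have hf : ∀ (x y : ℤˣ) i, termValue ![x, y] (f i) =
      if a i = c i then a i else if a i = t then x else y := by
    intro x y i
    simp only [f]
    split_ifs <;> rfl
  refine ⟨fun x y => (fun i => termValue ![x, y] (f i)) ∈ R.carrier, ?_, ?_, ?_, ?_⟩
  · refine ((PPDef.of_mem hR).subst f).congr fun φ => ?_
    have e : ![φ 0, φ 1] = φ := funext fun i => by fin_cases i <;> rfl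
    simp only [e]
  · convert ha using 1
    funext i
    rw [hf]
    generalize a i = p, c i = q
    clear * -
    revert p q t
    decide
  · convert hc using 1
    funext i
    rw [hf]
    generalize a i = p, c i = q
    clear * -
    revert p q t
    decide
  · intro h
    refine hac ?_
    convert h using 1
    funext i
    rw [hf, meetAt]
    generalize a i = p, c i = q
    clear * -
    revert p q t
    decide

/-- Failure of closure under AND rules out `(1, 1)`, failure of closure under OR rules out `(-1,
-1)`, and both relations keep the two mixed pairs. -/
theorem ppDef_neg (hhorn : ¬ L.IsHorn) (hdual : ¬ L.IsDualHorn) :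
    PPDef L (fun φ : Fin 2 → ℤˣ => φ 0 = -φ 1) := by
  simp only [ConstraintLanguage.IsHorn, ConstraintLanguage.IsDualHorn] at hhorn hdual
  push Not at hhorn hdual
  obtain ⟨R, hR, hRh⟩ := hhorn
  obtain ⟨R', hR', hRd⟩ := hdual
  obtain ⟨P, hP, h1, h2, h3⟩ := exists_binary_of_not_meet_closed hR (-1) fun h => hRh (by
    simpa [BoolRel.IsHorn] using exists_cnf_of_meet_closed true R.carrier h)
  obtain ⟨Q, hQ, g1, g2, g3⟩ := exists_binary_of_not_meet_closed hR' 1 fun h => hRd (by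
    simpa [BoolRel.IsDualHorn] using exists_cnf_of_meet_closed false R'.carrier h)
  rw [neg_neg] at h1 h2 h3
  refine (hP.and hQ).congr fun φ => ?_
  rcases Int.units_eq_one_or (φ 0) with e | e <;> rcases Int.units_eq_one_or (φ 1) with e' | e' <;>
    simp [e, e', h1, h2, h3, g1, g2, g3]

variable {V : Type}

theorem PPDef.neg (hneg : PPDef L (fun φ : Fin 2 → ℤˣ => φ 0 = -φ 1)) (s t : V ⊕ ℤˣ) :
    PPDef L (fun φ : V → ℤˣ => termValue φ s = -termValue φ t) :=
  hneg.subst ![s, t]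

/-- Equality is not built into `PPDef`; it is recovered as a double negation through an auxiliary
variable. -/
theorem PPDef.eq (hneg : PPDef L (fun φ : Fin 2 → ℤˣ => φ 0 = -φ 1)) (s t : V ⊕ ℤˣ) :
    PPDef L (fun φ : V → ℤˣ => termValue φ s = termValue φ t) := by
  have h : PPDef L (fun φ : Fin 2 ⊕ Unit → ℤˣ =>
      φ (Sum.inl 0) = -φ (Sum.inr ()) ∧ φ (Sum.inr ()) = -φ (Sum.inl 1)) :=
    (hneg.rename ![Sum.inl 0, Sum.inr ()]).and (hneg.rename ![Sum.inr (), Sum.inl 1])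
  refine (h.exists_.subst ![s, t]).congr fun φ => ?_
  constructor
  · intro h
    exact ⟨fun _ => -termValue φ s, (neg_neg _).symm, congrArg (-·) h⟩
  · rintro ⟨ψ, h1, h2⟩
    exact h1.trans ((congrArg (-·) h2).trans (neg_neg _))

/-- Substitution of signed terms for variables. -/
theorem PPDef.substSigned {κ : Type} [Finite κ] {P : (κ → ℤˣ) → Prop} (hP : PPDef L P)
    (hneg : PPDef L (fun φ : Fin 2 → ℤˣ => φ 0 = -φ 1)) (σ : κ → ℤˣ) (f : κ → V ⊕ ℤˣ) :
    PPDef L (fun φ : V → ℤˣ => P fun j => σ j * termValue φ (f j)) := by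
  have key : ∀ j, PPDef L (fun χ : V ⊕ κ → ℤˣ =>
      χ (Sum.inr j) = σ j * termValue (fun v => χ (Sum.inl v)) (f j)) := by
    intro j
    have ht : ∀ χ : V ⊕ κ → ℤˣ, termValue (fun v => χ (Sum.inl v)) (f j) =
        termValue χ (Sum.map Sum.inl id (f j)) := by
      intro χ
      cases f j <;> rfl
    rcases Int.units_eq_one_or (σ j) with h | h
    · exact (PPDef.eq hneg (Sum.inl (Sum.inr j)) (Sum.map Sum.inl id (f j))).congr fun χ => by
        rw [h, one_mul, ht]
        exact Iff.rfl
    · exact (PPDef.neg hneg (Sum.inl (Sum.inr j)) (Sum.map Sum.inl id (f j))).congr fun χ => by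
        rw [h, neg_one_mul, ht]
        exact Iff.rfl
  refine ((hP.rename (Sum.inr (α := V))).and (PPDef.forall_ key)).exists_.congr fun φ => ?_
  constructor
  · intro h
    exact ⟨_, h, fun _ => rfl⟩
  · rintro ⟨ψ, h, hψ⟩
    change P ψ at h
    rwa [show ψ = fun j => σ j * termValue φ (f j) from funext hψ] at h

theorem PPDef.substSigned₃ {P : ℤˣ → ℤˣ → ℤˣ → Prop}
    (hP : PPDef L (fun φ : Fin 3 → ℤˣ => P (φ 0) (φ 1) (φ 2)))
    (hneg : PPDef L (fun φ : Fin 2 → ℤˣ => φ 0 = -φ 1))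
    (a b c : ℤˣ) (r s t : V ⊕ ℤˣ) :
    PPDef L (fun φ : V → ℤˣ => P (a * termValue φ r) (b * termValue φ s) (c * termValue φ t)) :=
  hP.substSigned hneg ![a, b, c] ![r, s, t]

theorem exists_ternary_of_not_maj_closed
    (hneg : PPDef L (fun φ : Fin 2 → ℤˣ => φ 0 = -φ 1)) (hbij : ¬ L.IsBijunctive) :
    ∃ P : ℤˣ → ℤˣ → ℤˣ → Prop, PPDef L (fun φ : Fin 3 → ℤˣ => P (φ 0) (φ 1) (φ 2)) ∧
      P (-1) 1 1 ∧ P 1 (-1) 1 ∧ P 1 1 (-1) ∧ ¬ P 1 1 1 := by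
  simp only [ConstraintLanguage.IsBijunctive] at hbij
  push Not at hbij
  obtain ⟨R, hR, hRb⟩ := hbij
  have h := mt (exists_cnf_of_maj_closed R.arity_pos R.carrier) hRb
  push Not at h
  obtain ⟨a, ha, b, hb, c, hc, hm⟩ := h
  -- At each coordinate at most one of `a`, `b`, `c` differs from the majority `m`. Multiplying by
  -- `m` and assigning one variable to each culprit, setting a single variable to `-1` recovers `a`,
  -- `b` or `c`, and `(1, 1, 1)` gives `m`, which is outside `R`.
  let m : Fin R.arity → ℤˣ := fun i => maj (a i) (b i) (c i)
  let f : Fin R.arity → Fin 3 ⊕ ℤˣ := fun i =>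
    if a i ≠ m i then Sum.inl 0 else if b i ≠ m i then Sum.inl 1 else
      if c i ≠ m i then Sum.inl 2 else Sum.inr 1
  have hf : ∀ (x y z : ℤˣ) i, m i * termValue ![x, y, z] (f i) =
      maj (a i) (b i) (c i) * if a i ≠ maj (a i) (b i) (c i) then x else
        if b i ≠ maj (a i) (b i) (c i) then y else if c i ≠ maj (a i) (b i) (c i) then z else 1 := by
    intro x y z i
    simp only [f, m]
    split_ifs <;> rfl
  refine ⟨fun x y z => (fun i => m i * termValue ![x, y, z] (f i)) ∈ R.carrier, ?_, ?_, ?_, ?_, ?_⟩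
  · refine ((PPDef.of_mem hR).substSigned hneg m f).congr fun φ => ?_
    have e : ![φ 0, φ 1, φ 2] = φ := funext fun i => by fin_cases i <;> rfl
    simp only [e]
  · convert ha using 1
    funext i
    rw [hf]
    generalize a i = p, b i = q, c i = r
    clear * -
    revert p q r
    unfold maj
    decide
  · convert hb using 1
    funext i
    rw [hf]
    generalize a i = p, b i = q, c i = r
    clear * -
    revert p q r
    unfold maj
    decide
  · convert hc using 1
    funext i
    rw [hf]
    generalize a i = p, b i = q, c i = r
    clear * -
    revert p q r
    unfold maj
    decide
  · intro h
    refine hm ?_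
    convert h using 1
    funext i
    rw [hf]
    simp

/-- A symmetric version of the relation in `exists_ternary_of_not_maj_closed`. -/
theorem exists_symmetric_ternary
    (hneg : PPDef L (fun φ : Fin 2 → ℤˣ => φ 0 = -φ 1)) (hbij : ¬ L.IsBijunctive) :
    ∃ Q Q' : Prop, PPDef L (fun φ : Fin 3 → ℤˣ =>
      (φ 0 * φ 1 * φ 2 = -1 ∨ Q) ∧ (φ 0 = -1 ∧ φ 1 = -1 ∧ φ 2 = -1 → Q') ∧
        ¬ (φ 0 = 1 ∧ φ 1 = 1 ∧ φ 2 = 1)) := by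
  obtain ⟨P, hP, h0, h1, h2, h3⟩ := exists_ternary_of_not_maj_closed hneg hbij
  -- Conjoin all six permutations of `P`. Assignments with exactly two TRUE survive together or not
  -- at all (`Q`), and `Q'` decides the all-TRUE one.
  refine ⟨P (-1) (-1) 1 ∧ P (-1) 1 (-1) ∧ P 1 (-1) (-1), P (-1) (-1) (-1),
    (hP.and ((hP.rename ![0, 2, 1]).and ((hP.rename ![1, 0, 2]).and ((hP.rename ![1, 2, 0]).and
      ((hP.rename ![2, 0, 1]).and (hP.rename ![2, 1, 0])))))).congr fun φ => ?_⟩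
  rcases Int.units_eq_one_or (φ 0) with e | e <;> rcases Int.units_eq_one_or (φ 1) with e' | e' <;>
    rcases Int.units_eq_one_or (φ 2) with e'' | e'' <;>
    simp [e, e', e'', h0, h1, h2, h3] <;> tauto

/-- The four signed clauses exclude exactly the four assignments with product `1`. -/
theorem ppDef_parity_of_clause (hneg : PPDef L (fun φ : Fin 2 → ℤˣ => φ 0 = -φ 1))
    (h : PPDef L (fun φ : Fin 3 → ℤˣ => ¬ (φ 0 = 1 ∧ φ 1 = 1 ∧ φ 2 = 1))) :
    PPDef L (fun φ : Fin 3 → ℤˣ => φ 0 * φ 1 * φ 2 = -1) := by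
  have h' := fun a b c : ℤˣ => PPDef.substSigned₃ (V := Fin 3)
    (P := fun x y z => ¬ (x = 1 ∧ y = 1 ∧ z = 1)) h hneg a b c (Sum.inl 0) (Sum.inl 1) (Sum.inl 2)
  refine ((h' 1 1 1).and ((h' 1 (-1) (-1)).and ((h' (-1) 1 (-1)).and (h' (-1) (-1) 1)))).congr
    fun φ => ?_
  simp only [termValue, Sum.elim_inl]
  generalize φ 0 = p, φ 1 = q, φ 2 = r
  revert p q r
  decide

set_option synthInstance.maxHeartbeats 400000 in
set_option synthInstance.maxSize 4000 in
theorem ppDef_parity (hneg : PPDef L (fun φ : Fin 2 → ℤˣ => φ 0 = -φ 1))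
    (hbij : ¬ L.IsBijunctive) :
    PPDef L (fun φ : Fin 3 → ℤˣ => φ 0 * φ 1 * φ 2 = -1) := by
  obtain ⟨Q, Q', h⟩ := exists_symmetric_ternary hneg hbij
  by_cases hQ : Q <;> by_cases hQ' : Q' <;> simp only [hQ, hQ', or_true, or_false, true_and,
    implies_true, imp_false] at h
  · exact ppDef_parity_of_clause hneg h
  · refine ppDef_parity_of_clause hneg ?_
    have h' := PPDef.substSigned₃ (V := Fin 3 ⊕ Unit)
      (P := fun x y z => ¬ (x = -1 ∧ y = -1 ∧ z = -1) ∧ ¬ (x = 1 ∧ y = 1 ∧ z = 1)) h hneg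
    refine ((h' 1 1 1 (Sum.inl (Sum.inl 0)) (Sum.inl (Sum.inl 1)) (Sum.inl (Sum.inr ()))).and
      (h' (-1) 1 1 (Sum.inl (Sum.inr ())) (Sum.inl (Sum.inl 2)) (Sum.inr 1))).exists_unit.congr
      fun φ => ?_
    simp only [termValue, Sum.elim_inl, Sum.elim_inr, id]
    generalize φ 0 = p, φ 1 = q, φ 2 = r
    clear * -
    revert p q r
    decide
  · refine h.congr fun φ => ?_
    generalize φ 0 = p, φ 1 = q, φ 2 = r
    clear * -
    revert p q r
    decide
  -- Exactly-one of three. Counting TRUE as 1 and FALSE as 0, the five constraints say `p = w₀ +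
  -- w₃`, `q = w₁ + w₃`, `r = w₂ + w₃`, `w₀ + w₁ + w₄ = 1` and `w₄ = w₂ + w₃`. Hence `p + q + r = 1
  -- + 2 w₃` is odd.
  · have h' := fun a b c : ℤˣ => PPDef.substSigned₃ (V := Fin 3 ⊕ Fin 5) (P := fun x y z =>
      x * y * z = -1 ∧ ¬ (x = -1 ∧ y = -1 ∧ z = -1) ∧ ¬ (x = 1 ∧ y = 1 ∧ z = 1)) h hneg a b c
    let v : Fin 3 → (Fin 3 ⊕ Fin 5) ⊕ ℤˣ := fun i => Sum.inl (Sum.inl i)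
    let w : Fin 5 → (Fin 3 ⊕ Fin 5) ⊕ ℤˣ := fun i => Sum.inl (Sum.inr i)
    refine ((h' 1 1 (-1) (w 0) (w 3) (v 0)).and ((h' 1 1 (-1) (w 1) (w 3) (v 1)).and
      ((h' 1 1 (-1) (w 2) (w 3) (v 2)).and ((h' 1 1 1 (w 0) (w 1) (w 4)).and
      (h' 1 1 (-1) (w 2) (w 3) (w 4)))))).exists_.congr fun φ => ?_
    simp only [termValue, Sum.elim_inl, Sum.elim_inr, v, w]
    constructor
    · generalize φ 0 = p, φ 1 = q, φ 2 = r
      intro h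
      -- The first four witnesses are the indicators of the four values of `(p, q)`; the last is
      -- TRUE exactly when `p = q`, which by parity is `r`.
      refine ⟨![if p = -1 ∧ q = 1 then -1 else 1, if p = 1 ∧ q = -1 then -1 else 1,
        if p = 1 ∧ q = 1 then -1 else 1, if p = -1 ∧ q = -1 then -1 else 1, -(p * q)], ?_⟩
      revert h
      clear * -
      revert p q r
      decide
    · rintro ⟨ψ, h⟩
      revert h
      generalize φ 0 = p, φ 1 = q, φ 2 = r, ψ 0 = p₀, ψ 1 = p₁, ψ 2 = p₂, ψ 3 = p₃, ψ 4 = p₄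
      clear * -
      revert p q r p₀ p₁ p₂ p₃ p₄
      decide

theorem ppDef_list_prod (hneg : PPDef L (fun φ : Fin 2 → ℤˣ => φ 0 = -φ 1))
    (hpar : PPDef L (fun φ : Fin 3 → ℤˣ => φ 0 * φ 1 * φ 2 = -1)) {κ : Type} (l : List κ) :
    ∀ {V : Type} (f : κ → V ⊕ ℤˣ) (t : V ⊕ ℤˣ), PPDef L (fun φ : V → ℤˣ =>
      (l.map fun j => termValue φ (f j)).prod = termValue φ t) := by
  induction l with
  | nil => exact fun f t => PPDef.eq hneg (Sum.inr 1) t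
  | cons a l ih =>
    -- The new variable holds the product of the tail; one parity constraint, with `t` negated, then
    -- says that it multiplies with the head to `t`.
    intro V f t
    have h1 := ih (V := V ⊕ Unit) (fun j => Sum.map Sum.inl id (f j)) (Sum.inl (Sum.inr ()))
    have h2 := PPDef.substSigned₃ (V := V ⊕ Unit) (P := fun x y z => x * y * z = -1) hpar hneg
      1 1 (-1) (Sum.map Sum.inl id (f a)) (Sum.inl (Sum.inr ())) (Sum.map Sum.inl id t)
    refine (h1.and h2).exists_.congr fun φ => ?_
    have ht : ∀ (ψ : Unit → ℤˣ) (s : V ⊕ ℤˣ),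
        termValue (Sum.elim φ ψ) (Sum.map Sum.inl id s) = termValue φ s := by
      intro ψ s
      cases s <;> rfl
    simp only [ht, List.map_cons, List.prod_cons]
    have hu : ∀ x y z : ℤˣ, x * y = z ↔ 1 * x * (1 * y) * (-1 * z) = -1 := by decide
    constructor
    · intro h
      exact ⟨fun _ => _, rfl, (hu _ _ _).1 h⟩
    · rintro ⟨ψ, h, h'⟩
      rw [h]
      exact (hu _ _ _).2 h'

theorem ppDef_satisfies_of_linear (hbij : ¬ L.IsBijunctive) (hhorn : ¬ L.IsHorn)
    (hdual : ¬ L.IsDualHorn) {V : Type} (W : BCS V) (hW : W.Over LIN) :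
    PPDef L W.Satisfies := by
  have hneg := ppDef_neg hhorn hdual
  have hpar := ppDef_parity hneg hbij
  refine PPDef.forall_mem W.finite_constraints fun C hC => ?_
  obtain ⟨E, hE⟩ := hW C hC
  rw [hE]
  refine (PPDef.forall_mem (List.finite_toSet E) fun e _ =>
    (ppDef_list_prod hneg hpar e.1.toList C.scope (Sum.inr e.2))).congr fun φ => ?_
  refine forall₂_congr fun e _ => ?_
  rw [Finset.prod_map_toList]
  exact Iff.rfl

end Definability

end BCSAlgebra

end

theorem mainTheorem9 (U : Ultrafilter ℕ) (hU : (U : Filter ℕ) ≤ Filter.cofinite)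
    (hLIN : ∃ B : BCSAlgebra.ContextBCS, B.Over BCSAlgebra.LIN ∧
      B.IsTraciallySatisfiable ∧ ¬ B.IsUltrapowerSatisfiable U)
    (L : BCSAlgebra.ConstraintLanguage)
    (hbij : ¬ L.IsBijunctive) (hhorn : ¬ L.IsHorn) (hdual : ¬ L.IsDualHorn) :
    ∃ B : BCSAlgebra.ContextBCS, B.Over L ∧
      B.IsTraciallySatisfiable ∧ ¬ B.IsUltrapowerSatisfiable U := by
  obtain ⟨B, hB, htr, hsat⟩ := hLIN
  exact B.exists_separation_of_ppDef
    (fun i => BCSAlgebra.ppDef_satisfies_of_linear hbij hhorn hdual (B.V i) (hB i)) htr hsat
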